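/- For $\beta\ge 0$ let $$h^\beta=\Big\{v=(v_k)_{k\ge1}\subset\mathbb R:\ \|v\|_{h^\beta}^2=\sum_{k\ge1}k^{2\beta}v_k^2<\infty\Big\}.$$ For $\mu\in\mathbb R$ and integers $k\ge1$ put $$A_k(\mu)=\mu(2k-1)(2k+2)-\frac{2k(2k-3)(2k-1)}{(4k+1)(4k-1)}-\frac{(2k-1)(2k+1)(2k+2)}{(4k+1)(4k+3)},$$ $$B_k=\frac{2k(2k-3)(2k-1)}{(4k-3)(4k-1)}\sqrt{\frac{4k-3}{4k+1}},\qquad C_k=\frac{(2k-1)(2k+1)(2k+2)}{(4k+3)(4k+5)}\sqrt{\frac{4k+5}{4k+1}}.$$ Let $\alpha\ge0$ and let $\mathcal A(\mu):h^{\alpha+2}\to h^\alpha$ be the bounded linear operator $$(\mathcal A(\mu)v)_1=A_1(\mu)v_1+C_1v_2,\qquad (\mathcal A(\mu)v)_k=A_k(\mu)v_k+B_kv_{k-1}+C_kv_{k+1}\quad(k\ge2).$$ Write $N$ for the nullspace and $R$ for the range of an operator. Then: a) For every $\mu\ne0$, $\mathcal A(\mu)$ is a Fredholm operator of index $0$,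 and it is symmetric, that is, $\sum_k v_k(\mathcal A(\mu)w)_k=\sum_k(\mathcal A(\mu)v)_kw_k$ (with convergent sums) for all $v,w\in h^{\alpha+2}$. b) For every $\mu>0$, $N(\mathcal A(\mu))$ is at most one-dimensional and $N(\mathcal A(\mu))\subset h^\beta$ for all $\beta\ge0$. Moreover, $N(\mathcal A(\mu))=\{0\}$ for every $\mu\le0$. There is a strictly decreasing sequence $(\mu_k)_{k\ge1}$ of positive numbers with limit $0$ such that: c) $N(\mathcal A(\mu_k))$ is one-dimensional for every $k$, and $\mathcal A(\mu)$ is invertible (with bounded inverse) for every $\mu\notin\{\mu_k:k\ge1\}\cup\{0\}$; d) $\displaystyle\mu_1\le\frac{\sqrt2}{21\sqrt5}+\frac{\sqrt5}{22\sqrt{13}}+\frac{127}{2079}\approx0.119394$ (the decimal value being correct to within $5\cdot10^{-7}$); e) for every $k$, the map $\mu\mapsto\mathcal A(\mu)$ is differentiable at $\mu_k$ in the operator norm, and the transversality condition $\mathrm D_\mu\mathcal A(\mu)|_{\mu=\mu_k}v\notin R(\mathcal A(\mu_k))$ holds for every $0\ne v\in N(\mathcal A(\mu_k))$. -/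

import Mathlib

open Topology Filter

noncomputable section

/-! ### The weighted sequence spaces

A sequence `(v_k)_{k ≥ 1}` of real numbers is written as `v : ℕ → ℝ`, where `v n` is the entry
with the index `k = n + 1`. -/

/-- The real sequences `(v_k)_{k ≥ 1}` with `∑ k ^ (2 α) * v_k ^ 2 < ∞`. -/
def hSubmodule (α : ℝ) : Submodule ℝ (ℕ → ℝ) where
  carrier := {v | Summable fun n : ℕ => ((n : ℝ) + 1) ^ (2 * α) * v n ^ 2}
  zero_mem' := by simp
  add_mem' := by
    intro a b ha hb
    refine Summable.of_nonneg_of_le (fun n => by positivity) (fun n => ?_)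
      ((ha.mul_left 2).add (hb.mul_left 2))
    have h : (0 : ℝ) ≤ ((n : ℝ) + 1) ^ (2 * α) := by positivity
    simp only [Pi.add_apply]
    nlinarith [mul_nonneg h (sq_nonneg (a n - b n))]
  smul_mem' := by
    intro c a ha
    refine (ha.mul_left (c ^ 2)).congr (fun n => ?_)
    simp only [Pi.smul_apply, smul_eq_mul]
    ring

/-- The space `h^α` as a type of its own, so that it does not inherit the product topology. -/
def WeightedSeq (α : ℝ) : Type := hSubmodule α

namespace WeightedSeq

variable {α : ℝ}

instance : AddCommGroup (WeightedSeq α) := inferInstanceAs (AddCommGroup (hSubmodule α))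

instance : Module ℝ (WeightedSeq α) := inferInstanceAs (Module ℝ (hSubmodule α))

/-- The underlying sequence of an element of `h^α`, as a linear map. -/
def toSeq (α : ℝ) : WeightedSeq α →ₗ[ℝ] (ℕ → ℝ) := (hSubmodule α).subtype

instance : CoeFun (WeightedSeq α) (fun _ => ℕ → ℝ) := ⟨fun v => toSeq α v⟩

/-- An element of `h^α` from a sequence with finite weighted norm. -/
def mk (v : ℕ → ℝ) (hv : v ∈ hSubmodule α) : WeightedSeq α := ⟨v, hv⟩

@[simp] theorem mk_apply (v : ℕ → ℝ) (hv : v ∈ hSubmodule α) (n : ℕ) : mk v hv n = v n := rfl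

theorem ext {v w : WeightedSeq α} (h : ∀ n, v n = w n) : v = w := Subtype.ext (funext h)

theorem mem (v : WeightedSeq α) : toSeq α v ∈ hSubmodule α := v.2

theorem summable (v : WeightedSeq α) :
    Summable fun n : ℕ => ((n : ℝ) + 1) ^ (2 * α) * v n ^ 2 := v.2

@[simp] theorem add_apply (v w : WeightedSeq α) (n : ℕ) : (v + w) n = v n + w n := by simp

@[simp] theorem smul_apply (c : ℝ) (v : WeightedSeq α) (n : ℕ) : (c • v) n = c * v n := by simp

theorem weight_sq (α : ℝ) (n : ℕ) (x : ℝ) :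
    (((n : ℝ) + 1) ^ α * x) ^ 2 = ((n : ℝ) + 1) ^ (2 * α) * x ^ 2 := by
  rw [mul_pow, ← Real.rpow_natCast (((n : ℝ) + 1) ^ α) 2, ← Real.rpow_mul (by positivity),
    mul_comm α]
  norm_num

/-- The weighted sequence `(k ^ α * v_k)_{k ≥ 1}` as an element of `ℓ²`. -/
def toLp (α : ℝ) : WeightedSeq α →ₗ[ℝ] lp (fun _ : ℕ => ℝ) 2 where
  toFun v := ⟨fun n => ((n : ℝ) + 1) ^ α * v n, by
    refine (memℓp_gen_iff (by norm_num)).2 ?_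
    refine v.summable.congr (fun n => ?_)
    rw [← weight_sq]
    simp [← abs_mul]⟩
  map_add' v w := by
    ext n
    exact mul_add _ _ _
  map_smul' c v := by
    ext n
    exact mul_left_comm _ _ _

@[simp] theorem toLp_apply (v : WeightedSeq α) (n : ℕ) :
    (toLp α v : ℕ → ℝ) n = ((n : ℝ) + 1) ^ α * v n := rfl

theorem toLp_injective (α : ℝ) : Function.Injective (toLp α) := by
  intro v w h
  refine ext (fun n => ?_)
  have hn := congrArg (fun u : lp (fun _ : ℕ => ℝ) 2 => (u : ℕ → ℝ) n) h
  have hpos : ((n : ℝ) + 1) ^ α ≠ 0 := (by positivity : (0 : ℝ) < ((n : ℝ) + 1) ^ α).ne'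
  exact mul_left_cancel₀ hpos hn

instance : NormedAddCommGroup (WeightedSeq α) :=
  NormedAddCommGroup.induced (WeightedSeq α) (lp (fun _ : ℕ => ℝ) 2) (toLp α) (toLp_injective α)

instance : NormedSpace ℝ (WeightedSeq α) :=
  NormedSpace.induced ℝ (WeightedSeq α) (lp (fun _ : ℕ => ℝ) 2) (toLp α)

/-- The norm of `h^α` is given by `‖v‖ ^ 2 = ∑ k ^ (2 α) * v_k ^ 2`. -/
theorem norm_sq_eq (v : WeightedSeq α) :
    ‖v‖ ^ 2 = ∑' n : ℕ, ((n : ℝ) + 1) ^ (2 * α) * v n ^ 2 := by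
  have h : ‖v‖ = ‖toLp α v‖ := rfl
  have h2 := lp.norm_rpow_eq_tsum (p := 2) (by norm_num) (toLp α v)
  rw [h]
  simp only [ENNReal.toReal_ofNat, Real.rpow_ofNat] at h2
  rw [h2]
  refine tsum_congr (fun n => ?_)
  rw [← weight_sq]
  simp [← abs_mul]

/-- Weighted composition with an index map, injective where the weight does not vanish. -/
theorem comp_bound {α β M : ℝ} {c : ℕ → ℝ} {σ : ℕ → ℕ} (hσ : Set.InjOn σ {n | c n ≠ 0})
    (hc : ∀ n, |c n| * ((n : ℝ) + 1) ^ α ≤ M * ((σ n : ℝ) + 1) ^ β) (v : WeightedSeq β) :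
    ∃ w : WeightedSeq α, (∀ n, w n = c n * v (σ n)) ∧ ‖w‖ ≤ M * ‖v‖ := by
  have hM : 0 ≤ M := by
    have h0 := hc 0
    have h1 : 0 ≤ |c 0| * (((0 : ℕ) : ℝ) + 1) ^ α := by positivity
    have h2 : 0 < ((σ 0 : ℝ) + 1) ^ β := by positivity
    by_contra h
    nlinarith
  have key : ∀ s : Finset ℕ,
      ∑ n ∈ s, ((n : ℝ) + 1) ^ (2 * α) * (c n * v (σ n)) ^ 2 ≤ M ^ 2 * ‖v‖ ^ 2 := by
    intro s
    classical
    have hterm : ∀ n : ℕ, ((n : ℝ) + 1) ^ (2 * α) * (c n * v (σ n)) ^ 2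
        ≤ M ^ 2 * (((σ n : ℝ) + 1) ^ (2 * β) * v (σ n) ^ 2) := by
      intro n
      rw [← weight_sq, ← weight_sq, ← mul_pow]
      refine sq_le_sq.2 ?_
      have e1 : |((n : ℝ) + 1) ^ α| = ((n : ℝ) + 1) ^ α := abs_of_pos (by positivity)
      have e2 : |((σ n : ℝ) + 1) ^ β| = ((σ n : ℝ) + 1) ^ β := abs_of_pos (by positivity)
      simp only [abs_mul, abs_of_nonneg hM, e1, e2]
      nlinarith [mul_le_mul_of_nonneg_right (hc n) (abs_nonneg (v (σ n)))]
    calc ∑ n ∈ s, ((n : ℝ) + 1) ^ (2 * α) * (c n * v (σ n)) ^ 2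
        = ∑ n ∈ s with c n ≠ 0, ((n : ℝ) + 1) ^ (2 * α) * (c n * v (σ n)) ^ 2 := by
          rw [Finset.sum_filter]
          refine Finset.sum_congr rfl (fun n _ => ?_)
          split_ifs with h
          · rfl
          · simp [not_not.1 h]
      _ ≤ ∑ n ∈ s with c n ≠ 0, M ^ 2 * (((σ n : ℝ) + 1) ^ (2 * β) * v (σ n) ^ 2) :=
          Finset.sum_le_sum (fun n _ => hterm n)
      _ = ∑ m ∈ (s.filter (fun n => c n ≠ 0)).image σ,
            M ^ 2 * (((m : ℝ) + 1) ^ (2 * β) * v m ^ 2) := by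
          rw [Finset.sum_image]
          intro a ha b hb hab
          exact hσ (by simpa using (Finset.mem_filter.1 ha).2)
            (by simpa using (Finset.mem_filter.1 hb).2) hab
      _ ≤ M ^ 2 * ‖v‖ ^ 2 := by
          rw [← Finset.mul_sum, norm_sq_eq]
          exact mul_le_mul_of_nonneg_left
            (v.summable.sum_le_tsum _ (fun n _ => by positivity)) (by positivity)
  have hmem : (fun n => c n * v (σ n)) ∈ hSubmodule α :=
    summable_of_sum_le (fun n => by positivity) key
  refine ⟨mk _ hmem, fun n => rfl, ?_⟩
  refine le_of_sq_le_sq ?_ (by positivity)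
  rw [norm_sq_eq, mul_pow]
  exact (mk _ hmem).summable.tsum_le_of_sum_le key

end WeightedSeq

/-! ### The operator -/

/-- The diagonal coefficients `A_k(μ)`. -/
def coeffA (μ : ℝ) (k : ℕ) : ℝ :=
  μ * (2 * k - 1) * (2 * k + 2)
    - 2 * k * (2 * k - 3) * (2 * k - 1) / ((4 * k + 1) * (4 * k - 1))
    - (2 * k - 1) * (2 * k + 1) * (2 * k + 2) / ((4 * k + 1) * (4 * k + 3))

/-- The coefficients `B_k` below the diagonal. -/
def coeffB (k : ℕ) : ℝ :=
  2 * k * (2 * k - 3) * (2 * k - 1) / ((4 * k - 3) * (4 * k - 1))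
    * Real.sqrt ((4 * k - 3) / (4 * k + 1))

/-- The coefficients `C_k` above the diagonal. -/
def coeffC (k : ℕ) : ℝ :=
  (2 * k - 1) * (2 * k + 1) * (2 * k + 2) / ((4 * k + 3) * (4 * k + 5))
    * Real.sqrt ((4 * k + 5) / (4 * k + 1))

/-- The action of `𝒜(μ)` on sequences: its entry with index `k` is
`A_k(μ) v_k + B_k v_{k-1} + C_k v_{k+1}` for `k ≥ 2` and `A_1(μ) v_1 + C_1 v_2` for `k = 1`. -/
def seqOp (μ : ℝ) (v : ℕ → ℝ) : ℕ → ℝ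
  | 0 => coeffA μ 1 * v 0 + coeffC 1 * v 1
  | n + 1 => coeffA μ (n + 2) * v (n + 1) + coeffB (n + 2) * v n + coeffC (n + 2) * v (n + 2)

theorem seqOp_add (μ : ℝ) (v w : ℕ → ℝ) : seqOp μ (v + w) = seqOp μ v + seqOp μ w := by
  funext n
  cases n <;> simp only [seqOp, Pi.add_apply] <;> ring

theorem seqOp_smul (μ c : ℝ) (v : ℕ → ℝ) : seqOp μ (c • v) = c • seqOp μ v := by
  funext n
  cases n <;> simp only [seqOp, Pi.smul_apply, smul_eq_mul] <;> ring

theorem abs_coeffA_le (μ : ℝ) (n : ℕ) :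
    |coeffA μ (n + 1)| ≤ (6 * |μ| + 32) * ((n : ℝ) + 1) ^ 2 := by
  have hn : (0 : ℝ) ≤ n := Nat.cast_nonneg n
  have h1 : |μ * (2 * ((n : ℝ) + 1) - 1) * (2 * ((n : ℝ) + 1) + 2)|
      ≤ 6 * |μ| * ((n : ℝ) + 1) ^ 2 := by
    rw [mul_assoc, abs_mul, abs_of_nonneg
      (by nlinarith : 0 ≤ (2 * ((n : ℝ) + 1) - 1) * (2 * ((n : ℝ) + 1) + 2))]
    nlinarith [mul_le_mul_of_nonneg_left (by nlinarith :
      (2 * ((n : ℝ) + 1) - 1) * (2 * ((n : ℝ) + 1) + 2) ≤ 6 * ((n : ℝ) + 1) ^ 2) (abs_nonneg μ)]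
  have h2 : |2 * ((n : ℝ) + 1) * (2 * ((n : ℝ) + 1) - 3) * (2 * ((n : ℝ) + 1) - 1)
      / ((4 * ((n : ℝ) + 1) + 1) * (4 * ((n : ℝ) + 1) - 1))| ≤ 8 * ((n : ℝ) + 1) ^ 2 := by
    have hd : 0 < (4 * ((n : ℝ) + 1) + 1) * (4 * ((n : ℝ) + 1) - 1) := by nlinarith
    rw [abs_div, abs_of_pos hd, div_le_iff₀ hd, abs_le]
    constructor <;> ring_nf <;> nlinarith [pow_nonneg hn 2, pow_nonneg hn 3, pow_nonneg hn 4]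
  have h3 : |(2 * ((n : ℝ) + 1) - 1) * (2 * ((n : ℝ) + 1) + 1) * (2 * ((n : ℝ) + 1) + 2)
      / ((4 * ((n : ℝ) + 1) + 1) * (4 * ((n : ℝ) + 1) + 3))| ≤ 8 * ((n : ℝ) + 1) ^ 2 := by
    have hd : 0 < (4 * ((n : ℝ) + 1) + 1) * (4 * ((n : ℝ) + 1) + 3) := by nlinarith
    rw [abs_div, abs_of_pos hd, div_le_iff₀ hd, abs_le]
    constructor <;> ring_nf <;> nlinarith [pow_nonneg hn 2, pow_nonneg hn 3, pow_nonneg hn 4]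
  unfold coeffA
  push_cast
  refine (abs_sub _ _).trans ?_
  refine (add_le_add (abs_sub _ _) le_rfl).trans ?_
  nlinarith [sq_nonneg ((n : ℝ) + 1)]

theorem abs_coeffC_le (n : ℕ) : |coeffC (n + 1)| ≤ 16 * ((n : ℝ) + 1) ^ 2 := by
  have hn : (0 : ℝ) ≤ n := Nat.cast_nonneg n
  have h1 : |(2 * ((n : ℝ) + 1) - 1) * (2 * ((n : ℝ) + 1) + 1) * (2 * ((n : ℝ) + 1) + 2)
      / ((4 * ((n : ℝ) + 1) + 3) * (4 * ((n : ℝ) + 1) + 5))| ≤ 8 * ((n : ℝ) + 1) ^ 2 := by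
    have hd : 0 < (4 * ((n : ℝ) + 1) + 3) * (4 * ((n : ℝ) + 1) + 5) := by nlinarith
    rw [abs_div, abs_of_pos hd, div_le_iff₀ hd, abs_le]
    constructor <;> ring_nf <;> nlinarith [pow_nonneg hn 2, pow_nonneg hn 3, pow_nonneg hn 4]
  have h2 : |Real.sqrt ((4 * ((n : ℝ) + 1) + 5) / (4 * ((n : ℝ) + 1) + 1))| ≤ 2 := by
    rw [abs_of_nonneg (Real.sqrt_nonneg _), Real.sqrt_le_left (by norm_num),
      div_le_iff₀ (by nlinarith)]
    nlinarith
  unfold coeffC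
  push_cast
  rw [abs_mul]
  nlinarith [mul_le_mul h1 h2 (abs_nonneg _) (by positivity)]

theorem abs_coeffB_le (n : ℕ) : |coeffB (n + 2)| ≤ 16 * ((n : ℝ) + 1) ^ 2 := by
  have hn : (0 : ℝ) ≤ n := Nat.cast_nonneg n
  have h1 : |2 * ((n : ℝ) + 2) * (2 * ((n : ℝ) + 2) - 3) * (2 * ((n : ℝ) + 2) - 1)
      / ((4 * ((n : ℝ) + 2) - 3) * (4 * ((n : ℝ) + 2) - 1))| ≤ 16 * ((n : ℝ) + 1) ^ 2 := by
    have hd : 0 < (4 * ((n : ℝ) + 2) - 3) * (4 * ((n : ℝ) + 2) - 1) := by nlinarith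
    rw [abs_div, abs_of_pos hd, div_le_iff₀ hd, abs_le]
    constructor <;> ring_nf <;> nlinarith [pow_nonneg hn 2, pow_nonneg hn 3, pow_nonneg hn 4]
  have h2 : |Real.sqrt ((4 * ((n : ℝ) + 2) - 3) / (4 * ((n : ℝ) + 2) + 1))| ≤ 1 := by
    rw [abs_of_nonneg (Real.sqrt_nonneg _), Real.sqrt_le_left (by norm_num),
      div_le_iff₀ (by nlinarith)]
    nlinarith
  unfold coeffB
  push_cast
  rw [abs_mul]
  nlinarith [mul_le_mul h1 h2 (abs_nonneg _) (by positivity)]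

theorem rpow_le_two_mul (α : ℝ) {x y : ℝ} (hx : 0 < x) (hxy : x ≤ 2 * y) (hyx : y ≤ 2 * x) :
    x ^ α ≤ 2 ^ |α| * y ^ α := by
  have hy : 0 < y := by linarith
  rcases le_total 0 α with h | h
  · rw [abs_of_nonneg h, ← Real.mul_rpow (by norm_num) hy.le]
    exact Real.rpow_le_rpow hx.le hxy h
  · have h2 : (2 * x) ^ α ≤ y ^ α := Real.rpow_le_rpow_of_nonpos hy hyx h
    rw [Real.mul_rpow (by norm_num) hx.le] at h2
    have h3 : (2 : ℝ) ^ |α| * 2 ^ α = 1 := by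
      rw [abs_of_nonpos h, ← Real.rpow_add (by norm_num)]
      simp
    calc x ^ α = 2 ^ |α| * (2 ^ α * x ^ α) := by rw [← mul_assoc, h3, one_mul]
      _ ≤ 2 ^ |α| * y ^ α := mul_le_mul_of_nonneg_left h2 (by positivity)

theorem seqOp_bound (α μ : ℝ) : ∃ M : ℝ, ∀ v : WeightedSeq (α + 2),
    ∃ w : WeightedSeq α, (∀ n, w n = seqOp μ v n) ∧ ‖w‖ ≤ M * ‖v‖ := by
  have hw : ∀ n : ℕ, ((n : ℝ) + 1) ^ (α + 2) = ((n : ℝ) + 1) ^ 2 * ((n : ℝ) + 1) ^ α := by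
    intro n
    rw [Real.rpow_add (by positivity), mul_comm]
    norm_num
  refine ⟨(6 * |μ| + 32) + 16 * 2 ^ |α| + 16 * 2 ^ |α|, fun v => ?_⟩
  obtain ⟨w1, h1, n1⟩ := WeightedSeq.comp_bound (α := α) (M := 6 * |μ| + 32)
    (c := fun n => coeffA μ (n + 1)) (σ := id) Function.injective_id.injOn (fun n => by
      rw [id, hw, ← mul_assoc]
      exact mul_le_mul_of_nonneg_right (abs_coeffA_le μ n) (by positivity)) v
  obtain ⟨w2, h2, n2⟩ := WeightedSeq.comp_bound (α := α) (M := 16 * 2 ^ |α|)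
    (c := fun n => coeffC (n + 1)) (σ := fun n => n + 1) (add_left_injective 1).injOn (fun n => by
      have hn : (0 : ℝ) ≤ n := Nat.cast_nonneg n
      have ha := rpow_le_two_mul α (x := (n : ℝ) + 1) (y := ((n + 1 : ℕ) : ℝ) + 1)
        (by positivity) (by push_cast; linarith) (by push_cast; linarith)
      have hb : |coeffC (n + 1)| ≤ 16 * (((n + 1 : ℕ) : ℝ) + 1) ^ 2 := by
        refine (abs_coeffC_le n).trans ?_
        push_cast
        nlinarith
      rw [hw]
      calc _ ≤ _ := mul_le_mul hb ha (by positivity) (by positivity)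
        _ = _ := by ring) v
  obtain ⟨w3, h3, n3⟩ := WeightedSeq.comp_bound (α := α) (M := 16 * 2 ^ |α|)
    (c := fun n => if n = 0 then 0 else coeffB (n + 1)) (σ := fun n => n - 1)
    (by
      intro a ha b hb hab
      simp only [Set.mem_ofPred_eq, ne_eq, ite_eq_left_iff, not_forall] at ha hb
      obtain ⟨ha, -⟩ := ha
      obtain ⟨hb, -⟩ := hb
      simp only at hab
      omega)
    (fun n => by
      cases n with
      | zero => simpa using (by positivity : (0 : ℝ) ≤ 2 ^ |α|)
      | succ n =>
        have hn : (0 : ℝ) ≤ n := Nat.cast_nonneg n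
        have ha := rpow_le_two_mul α (x := ((n + 1 : ℕ) : ℝ) + 1) (y := (n : ℝ) + 1)
          (by positivity) (by push_cast; linarith) (by push_cast; linarith)
        have hb := abs_coeffB_le n
        simp only [Nat.succ_ne_zero, if_false, Nat.add_sub_cancel]
        rw [hw]
        calc _ ≤ _ := mul_le_mul hb ha (by positivity) (by positivity)
          _ = _ := by ring) v
  refine ⟨w1 + w2 + w3, fun n => ?_, ?_⟩
  · rw [WeightedSeq.add_apply, WeightedSeq.add_apply, h1, h2, h3]
    cases n with
    | zero => simp [seqOp]
    | succ n =>
      simp [seqOp]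
      ring
  · calc ‖w1 + w2 + w3‖ ≤ ‖w1‖ + ‖w2‖ + ‖w3‖ := norm_add₃_le
      _ ≤ _ := by linarith

theorem seqOp_mem (α μ : ℝ) (v : WeightedSeq (α + 2)) : seqOp μ v ∈ hSubmodule α := by
  obtain ⟨M, hM⟩ := seqOp_bound α μ
  obtain ⟨w, hw, -⟩ := hM v
  have h : WeightedSeq.toSeq α w = seqOp μ v := funext hw
  exact h ▸ w.mem

/-- The bounded operator `𝒜(μ) : h^{α+2} → h^α`. -/
def opA (α μ : ℝ) : WeightedSeq (α + 2) →L[ℝ] WeightedSeq α :=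
  LinearMap.mkContinuousOfExistsBound
    { toFun := fun v => WeightedSeq.mk (seqOp μ v) (seqOp_mem α μ v)
      map_add' := fun v w => WeightedSeq.ext fun n => by
        simp only [WeightedSeq.mk_apply, WeightedSeq.add_apply, map_add, seqOp_add, Pi.add_apply]
      map_smul' := fun c v => WeightedSeq.ext fun n => by
        simp only [WeightedSeq.mk_apply, WeightedSeq.smul_apply, map_smul, seqOp_smul, Pi.smul_apply,
          smul_eq_mul, RingHom.id_apply] }
    (by
      obtain ⟨M, hM⟩ := seqOp_bound α μ
      refine ⟨M, fun v => ?_⟩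
      obtain ⟨w, hw, hn⟩ := hM v
      have h : WeightedSeq.mk (seqOp μ v) (seqOp_mem α μ v) = w :=
        WeightedSeq.ext fun n => (hw n).symm
      exact (congrArg norm h).trans_le hn)

@[simp] theorem opA_apply (α μ : ℝ) (v : WeightedSeq (α + 2)) (n : ℕ) :
    opA α μ v n = seqOp μ v n := rfl

/-- Symmetry of an operator `h^{α+2} → h^α` for the scalar product of `ℓ²`. -/
def IsEllTwoSymmetric {α : ℝ} (T : WeightedSeq (α + 2) →L[ℝ] WeightedSeq α) : Prop :=
  ∀ v w : WeightedSeq (α + 2),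
    (Summable fun n : ℕ => v n * T w n) ∧ (Summable fun n : ℕ => T v n * w n) ∧
      ∑' n : ℕ, v n * T w n = ∑' n : ℕ, T v n * w n

/-- A Fredholm operator whose kernel and cokernel have the same dimension. -/
def IsFredholmOfIndexZero {E F : Type*} [NormedAddCommGroup E] [NormedSpace ℝ E]
    [NormedAddCommGroup F] [NormedSpace ℝ F] (T : E →L[ℝ] F) : Prop :=
  T.IsFredholm ∧
    (Module.finrank ℝ T.ker : ℤ) - (Module.finrank ℝ (F ⧸ T.range) : ℤ) = 0

end

/-
Write `𝒜(μ) = μ D + 𝒜(0)`. The diagonal operator `D` is an isomorphism from `h^(α+2)` to `h^α`, and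
the entries of `𝒜(0)` grow only linearly, so `𝒜(0)` is compact and `𝒜(μ)` is Fredholm of index `0`
for `μ ≠ 0`. The equation `𝒜(μ) v = 0` reads `μ D v = -𝒜(0) v`, so an element of the nullspace gains
one derivative at a time and is smooth. As a three-term recursion it is determined by `v₁`, so the
nullspace is at most one-dimensional. By symmetry the nullspace is orthogonal to the range, and
`⟨v, D v⟩ > 0` for `v ≠ 0`, which is the transversality.

The nullspace is nontrivial iff `μ` is an eigenvalue of `-D^{-1/2} 𝒜(0) D^{-1/2}`, a compact
symmetric operator on `ℓ²`; a bound for its row sums gives the bound for `μ₁`. Substituting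
`v_k = √(4 k + 1) u_k` turns `𝒜(0)` into a difference operator in divergence form: if `μ ≤ 0` and
`u₁ > 0`, then every `u_k` is at least `u₁ / 3`, so `v` does not tend to `0`. Hence all eigenvalues
are positive, and since the operator is injective there are infinitely many of them.
-/

section Growth

variable {r s : ℝ} {c d : ℕ → ℝ}

/-- The sequence `c` is `O(k ^ r)`, where `k = n + 1` is the index of the entry `c n`. Then the
multiplication by `c` is an operator of order `r` on the scale of the spaces `h^α`. -/
def HasGrowth (r : ℝ) (c : ℕ → ℝ) : Prop :=
  ∃ M : ℝ, ∀ n : ℕ, |c n| ≤ M * ((n : ℝ) + 1) ^ r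

namespace HasGrowth

theorem mono (hc : HasGrowth r c) (hrs : r ≤ s) : HasGrowth s c := by
  obtain ⟨M, hM⟩ := hc
  have hM0 : 0 ≤ M := by simpa using (abs_nonneg _).trans (hM 0)
  refine ⟨M, fun n => (hM n).trans (mul_le_mul_of_nonneg_left ?_ hM0)⟩
  exact Real.rpow_le_rpow_of_exponent_le (by simp) hrs

theorem mul (hc : HasGrowth r c) (hd : HasGrowth s d) :
    HasGrowth (r + s) fun n => c n * d n := by
  obtain ⟨M, hM⟩ := hc
  obtain ⟨L, hL⟩ := hd
  refine ⟨M * L, fun n => ?_⟩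
  calc |c n * d n| = |c n| * |d n| := abs_mul _ _
    _ ≤ (M * ((n : ℝ) + 1) ^ r) * (L * ((n : ℝ) + 1) ^ s) :=
      mul_le_mul (hM n) (hL n) (abs_nonneg _) ((abs_nonneg _).trans (hM n))
    _ = M * L * ((n : ℝ) + 1) ^ (r + s) := by rw [Real.rpow_add (by positivity)]; ring

theorem add (hc : HasGrowth r c) (hd : HasGrowth r d) : HasGrowth r fun n => c n + d n := by
  obtain ⟨M, hM⟩ := hc
  obtain ⟨L, hL⟩ := hd
  refine ⟨M + L, fun n => (abs_add_le _ _).trans ?_⟩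
  rw [add_mul]
  exact add_le_add (hM n) (hL n)

theorem const_mul (hc : HasGrowth r c) (x : ℝ) : HasGrowth r fun n => x * c n := by
  obtain ⟨M, hM⟩ := hc
  refine ⟨|x| * M, fun n => ?_⟩
  rw [abs_mul, mul_assoc]
  exact mul_le_mul_of_nonneg_left (hM n) (abs_nonneg x)

theorem neg (hc : HasGrowth r c) : HasGrowth r fun n => -c n := by
  simpa [HasGrowth] using hc

theorem sqrt (hc : HasGrowth r c) : HasGrowth (r / 2) fun n => √(c n) := by
  obtain ⟨M, hM⟩ := hc
  refine ⟨√M, fun n => ?_⟩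
  calc |√(c n)| = √(c n) := abs_of_nonneg (Real.sqrt_nonneg _)
    _ ≤ √(M * ((n : ℝ) + 1) ^ r) := Real.sqrt_le_sqrt ((le_abs_self _).trans (hM n))
    _ = √M * ((n : ℝ) + 1) ^ (r / 2) := by
      rw [Real.sqrt_mul' _ (by positivity), Real.sqrt_eq_rpow (_ ^ r),
        ← Real.rpow_mul (by positivity), mul_one_div]

theorem comp_succ (hc : HasGrowth r c) : HasGrowth r fun n => c (n + 1) := by
  obtain ⟨M, hM⟩ := hc
  have hM0 : 0 ≤ M := by simpa using (abs_nonneg _).trans (hM 0)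
  refine ⟨M * 2 ^ |r|, fun n => (hM (n + 1)).trans ?_⟩
  rw [mul_assoc]
  refine mul_le_mul_of_nonneg_left ?_ hM0
  push_cast
  exact rpow_le_two_mul r (by positivity) (by linarith) (by linarith)

end HasGrowth

end Growth

namespace WeightedSeq

variable {α β : ℝ}

@[simp] theorem sub_apply (v w : WeightedSeq α) (n : ℕ) : (v - w) n = v n - w n := by simp

theorem toSeq_injective (α : ℝ) : Function.Injective (toSeq α) := Subtype.val_injective

theorem toLp_surjective (α : ℝ) : Function.Surjective (toLp α) := by
  intro u
  have hpos (n : ℕ) : ((n : ℝ) + 1) ^ α ≠ 0 := by positivity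
  have hmem : (fun n : ℕ => (((n : ℝ) + 1) ^ α)⁻¹ * u n) ∈ hSubmodule α := by
    have hu : Summable fun n : ℕ => u n ^ 2 := by
      simpa using (memℓp_gen_iff (p := 2) (by norm_num)).1 (lp.memℓp u)
    refine hu.congr fun n => ?_
    rw [← weight_sq, mul_inv_cancel_left₀ (hpos n)]
  refine ⟨mk _ hmem, lp.ext (funext fun n => ?_)⟩
  rw [toLp_apply, mk_apply, mul_inv_cancel_left₀ (hpos n)]

/-- The isometric identification of `h^α` with `ℓ²`. -/
noncomputable def toLpEquiv (α : ℝ) : WeightedSeq α ≃ₗᵢ[ℝ] lp (fun _ : ℕ => ℝ) 2 :=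
  LinearIsometryEquiv.ofSurjective ⟨toLp α, fun _ => rfl⟩ (toLp_surjective α)

theorem toLpEquiv_apply (v : WeightedSeq α) (n : ℕ) :
    (toLpEquiv α v : ℕ → ℝ) n = ((n : ℝ) + 1) ^ α * v n := rfl

instance : CompleteSpace (WeightedSeq α) :=
  (toLpEquiv α).toIsometryEquiv.completeSpace

/-- The coordinate functionals on `h^α`. -/
noncomputable def evalCLM (α : ℝ) (n : ℕ) : WeightedSeq α →L[ℝ] ℝ :=
  LinearMap.mkContinuous
    { toFun := fun v => v n
      map_add' := fun v w => add_apply v w n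
      map_smul' := fun c v => smul_apply c v n } (((n : ℝ) + 1) ^ α)⁻¹ fun v => by
    have hpos : 0 < ((n : ℝ) + 1) ^ α := by positivity
    have h : ‖(toLp α v : ℕ → ℝ) n‖ ≤ ‖toLp α v‖ := lp.norm_apply_le_norm (by norm_num) _ n
    rw [toLp_apply, norm_mul, Real.norm_of_nonneg hpos.le] at h
    rwa [inv_mul_eq_div, le_div_iff₀ hpos, mul_comm]

@[simp] theorem evalCLM_apply (n : ℕ) (v : WeightedSeq α) : evalCLM α n v = v n := rfl

/-- The unit sequences in `h^α`. -/
noncomputable def unitSeq (α : ℝ) (i : ℕ) : WeightedSeq α :=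
  mk (Pi.single i 1) (by
    refine summable_of_ne_finset_zero (s := {i}) fun n hn => ?_
    have : n ≠ i := by simpa using hn
    simp [this])

theorem unitSeq_apply (i n : ℕ) : unitSeq α i n = if n = i then 1 else 0 :=
  Pi.single_apply i (1 : ℝ) n

section Comp

variable {M : ℝ} {c : ℕ → ℝ} {σ : ℕ → ℕ}

theorem comp_mem (hσ : Set.InjOn σ {n | c n ≠ 0})
    (hc : ∀ n, |c n| * ((n : ℝ) + 1) ^ α ≤ M * ((σ n : ℝ) + 1) ^ β) (v : WeightedSeq β) :
    (fun n => c n * v (σ n)) ∈ hSubmodule α := by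
  obtain ⟨w, hw, -⟩ := comp_bound hσ hc v
  exact (funext hw : toSeq α w = _) ▸ w.mem

/-- The weighted composition `v ↦ (c n * v (σ n))` as a bounded operator `h^β → h^α`. -/
noncomputable def compCLM (hσ : Set.InjOn σ {n | c n ≠ 0})
    (hc : ∀ n, |c n| * ((n : ℝ) + 1) ^ α ≤ M * ((σ n : ℝ) + 1) ^ β) :
    WeightedSeq β →L[ℝ] WeightedSeq α :=
  LinearMap.mkContinuous
    { toFun := fun v => mk (fun n => c n * v (σ n)) (comp_mem hσ hc v)
      map_add' := fun v w => ext fun n => by simp only [mk_apply, add_apply, mul_add]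
      map_smul' := fun x v => ext fun n => by
        simp only [mk_apply, smul_apply, RingHom.id_apply, mul_left_comm] } M fun v => by
    obtain ⟨w, hw, hn⟩ := comp_bound hσ hc v
    exact (congrArg norm (ext fun n => (hw n).symm : mk _ (comp_mem hσ hc v) = w)).trans_le hn

@[simp] theorem compCLM_apply (hσ : Set.InjOn σ {n | c n ≠ 0})
    (hc : ∀ n, |c n| * ((n : ℝ) + 1) ^ α ≤ M * ((σ n : ℝ) + 1) ^ β) (v : WeightedSeq β) (n : ℕ) :
    compCLM hσ hc v n = c n * v (σ n) := rfl

theorem norm_compCLM_le (hσ : Set.InjOn σ {n | c n ≠ 0})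
    (hc : ∀ n, |c n| * ((n : ℝ) + 1) ^ α ≤ M * ((σ n : ℝ) + 1) ^ β) :
    ‖compCLM hσ hc‖ ≤ M := by
  refine LinearMap.mkContinuous_norm_le _ ?_ _
  have h : 0 ≤ |c 0| * (((0 : ℕ) : ℝ) + 1) ^ α := by positivity
  exact nonneg_of_mul_nonneg_left (h.trans (hc 0)) (by positivity)

end Comp

section Mul

variable {r : ℝ} {c : ℕ → ℝ}

theorem exists_mul_rpow_le (hc : HasGrowth r c) (h : α + r ≤ β) :
    ∃ M : ℝ, ∀ n : ℕ, |c n| * ((n : ℝ) + 1) ^ α ≤ M * ((n : ℝ) + 1) ^ β := by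
  obtain ⟨M, hM⟩ := hc.mono (le_sub_iff_add_le'.2 h)
  refine ⟨M, fun n => (mul_le_mul_of_nonneg_right (hM n) (by positivity)).trans_eq ?_⟩
  rw [mul_assoc, ← Real.rpow_add (by positivity), sub_add_cancel]

/-- Multiplication by a sequence of growth `r`, as a bounded operator `h^β → h^α`. -/
noncomputable def mulCLM (hc : HasGrowth r c) (h : α + r ≤ β) :
    WeightedSeq β →L[ℝ] WeightedSeq α :=
  compCLM (c := c) (σ := id) Function.injective_id.injOn (exists_mul_rpow_le hc h).choose_spec

@[simp] theorem mulCLM_apply (hc : HasGrowth r c) (h : α + r ≤ β) (v : WeightedSeq β) (n : ℕ) :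
    mulCLM hc h v n = c n * v n := rfl

theorem isInvertible_mulCLM (hc : HasGrowth r c) (hc' : HasGrowth (-r) fun n => (c n)⁻¹)
    (hc0 : ∀ n, c n ≠ 0) (h : α + r = β) : (mulCLM hc h.le).IsInvertible :=
  ⟨ContinuousLinearEquiv.equivOfInverse (mulCLM hc h.le) (mulCLM hc' (by linarith))
    (fun v => ext fun n => by simp [hc0 n]) (fun v => ext fun n => by simp [hc0 n]), rfl⟩

end Mul

/-- The shift `(v_1, v_2, …) ↦ (v_2, v_3, …)` on `h^α`. -/
noncomputable def shiftLeft (α : ℝ) : WeightedSeq α →L[ℝ] WeightedSeq α :=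
  compCLM (c := 1) (σ := (· + 1)) (M := 2 ^ |α|) (add_left_injective 1).injOn fun n => by
    rw [Pi.one_apply, abs_one, one_mul]
    push_cast
    exact rpow_le_two_mul α (by positivity) (by linarith) (by linarith)

@[simp] theorem shiftLeft_apply (v : WeightedSeq α) (n : ℕ) : shiftLeft α v n = v (n + 1) :=
  one_mul _

theorem injOn_sub_one : Set.InjOn (· - 1) {n : ℕ | n ≠ 0} := fun _ hm _ hn =>
  Nat.sub_one_cancel (Nat.pos_of_ne_zero hm) (Nat.pos_of_ne_zero hn)

/-- The shift `(v_1, v_2, …) ↦ (0, v_1, …)` on `h^α`. -/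
noncomputable def shiftRight (α : ℝ) : WeightedSeq α →L[ℝ] WeightedSeq α :=
  compCLM (c := fun n => if n = 0 then 0 else 1) (σ := (· - 1)) (M := 2 ^ |α|)
    (injOn_sub_one.mono fun n hn => by rintro rfl; exact hn (if_pos rfl))
    fun n => by
      cases n with
      | zero => simpa using (by positivity : (0 : ℝ) ≤ 2 ^ |α|)
      | succ n =>
        rw [if_neg n.succ_ne_zero, abs_one, one_mul]
        push_cast
        exact rpow_le_two_mul α (by positivity) (by linarith) (by linarith)

@[simp] theorem shiftRight_zero (v : WeightedSeq α) : shiftRight α v 0 = 0 := by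
  rw [shiftRight, compCLM_apply, if_pos rfl, zero_mul]

@[simp] theorem shiftRight_succ (v : WeightedSeq α) (n : ℕ) : shiftRight α v (n + 1) = v n := by
  rw [shiftRight, compCLM_apply, if_neg n.succ_ne_zero, one_mul, Nat.add_sub_cancel]

end WeightedSeq

section Pairing

variable {α β r s t : ℝ} {c v w : ℕ → ℝ}

theorem HasGrowth.one : HasGrowth 0 1 := ⟨1, fun n => by simp⟩

theorem HasGrowth.mul_mem (hc : HasGrowth r c) (h : α + r ≤ β) (hv : v ∈ hSubmodule β) :
    (fun n => c n * v n) ∈ hSubmodule α :=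
  (WeightedSeq.mulCLM hc h (.mk v hv)).mem

theorem hSubmodule_antitone : Antitone hSubmodule := fun α β h v hv => by
  simpa using HasGrowth.one.mul_mem (α := α) (by simpa using h) hv

theorem comp_succ_mem (hv : v ∈ hSubmodule α) : (fun n => v (n + 1)) ∈ hSubmodule α := by
  have h : WeightedSeq.toSeq α (WeightedSeq.shiftLeft α (.mk v hv)) = fun n => v (n + 1) :=
    funext fun n => WeightedSeq.shiftLeft_apply _ n
  exact h ▸ WeightedSeq.mem _

theorem summable_mul_of_mem (hst : 0 ≤ s + t) (hv : v ∈ hSubmodule s) (hw : w ∈ hSubmodule t) :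
    Summable fun n => v n * w n := by
  have hw' : Summable fun n : ℕ => (((n : ℝ) + 1) ^ (-s) * w n) ^ 2 :=
    (hSubmodule_antitone (by linarith : -s ≤ t) hw).congr fun n =>
      (WeightedSeq.weight_sq (-s) n (w n)).symm
  have hv' : Summable fun n : ℕ => (((n : ℝ) + 1) ^ s * v n) ^ 2 :=
    hv.congr fun n => (WeightedSeq.weight_sq s n (v n)).symm
  refine Summable.of_norm_bounded (hv'.add hw') fun n => ?_
  have h1 : ((n : ℝ) + 1) ^ s * ((n : ℝ) + 1) ^ (-s) = 1 := by
    rw [← Real.rpow_add (by positivity), add_neg_cancel, Real.rpow_zero]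
  have h : v n * w n = (((n : ℝ) + 1) ^ s * v n) * (((n : ℝ) + 1) ^ (-s) * w n) := by
    linear_combination -(v n * w n) * h1
  rw [h, Real.norm_eq_abs, abs_mul]
  nlinarith [two_mul_le_add_sq |((n : ℝ) + 1) ^ s * v n| |((n : ℝ) + 1) ^ (-s) * w n|,
    sq_abs (((n : ℝ) + 1) ^ s * v n), sq_abs (((n : ℝ) + 1) ^ (-s) * w n),
    mul_nonneg (abs_nonneg (((n : ℝ) + 1) ^ s * v n)) (abs_nonneg (((n : ℝ) + 1) ^ (-s) * w n))]

theorem tendsto_zero_of_mem (hα : 0 ≤ α) (hv : v ∈ hSubmodule α) : Tendsto v atTop (𝓝 0) := by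
  have h := (summable_mul_of_mem (add_nonneg hα hα) hv hv).tendsto_atTop_zero
  refine (tendsto_zero_iff_abs_tendsto_zero v).2 ?_
  simpa [Real.sqrt_mul_self_eq_abs] using! h.sqrt

end Pairing

namespace WeightedSeq

variable {α β : ℝ}

/-- The inclusion of `h^β` into `h^α` for `α ≤ β`. -/
noncomputable def inclCLM (h : α ≤ β) : WeightedSeq β →L[ℝ] WeightedSeq α :=
  mulCLM HasGrowth.one ((add_zero α).trans_le h)

@[simp] theorem inclCLM_apply (h : α ≤ β) (v : WeightedSeq β) (n : ℕ) : inclCLM h v n = v n :=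
  one_mul _

/-- The finite rank operator `h^β → h^α` that keeps the first `N` entries of a sequence. -/
noncomputable def truncCLM (α β : ℝ) (N : ℕ) : WeightedSeq β →L[ℝ] WeightedSeq α :=
  ∑ i ∈ Finset.range N, (evalCLM β i).smulRight (unitSeq α i)

theorem truncCLM_apply (N : ℕ) (v : WeightedSeq β) (n : ℕ) :
    truncCLM α β N v n = if n < N then v n else 0 := by
  rw [← evalCLM_apply]
  simp only [truncCLM, _root_.sum_apply, map_sum, ContinuousLinearMap.smulRight_apply, map_smul,
    evalCLM_apply, unitSeq_apply, smul_eq_mul, mul_ite, mul_one, mul_zero, Finset.sum_ite_eq,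
    Finset.mem_range]

theorem isCompactOperator_truncCLM (N : ℕ) : IsCompactOperator (truncCLM α β N) :=
  (Submodule.sum_mem (compactOperator (RingHom.id ℝ) (WeightedSeq β) (WeightedSeq α)) fun i _ =>
    (isCompactOperator_of_locallyCompactSpace_dom (evalCLM β i)).clm_comp
      (ContinuousLinearMap.toSpanSingleton ℝ (unitSeq α i)) : truncCLM α β N ∈ _)

theorem norm_inclCLM_sub_truncCLM_le (h : α ≤ β) (N : ℕ) :
    ‖inclCLM h - truncCLM α β N‖ ≤ ((N : ℝ) + 1) ^ (-(β - α)) := by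
  have hc (n : ℕ) : |if n < N then (0 : ℝ) else 1| * ((n : ℝ) + 1) ^ α
      ≤ ((N : ℝ) + 1) ^ (-(β - α)) * ((n : ℝ) + 1) ^ β := by
    split_ifs with hn
    · rw [abs_zero, zero_mul]
      positivity
    · have hNn : (N : ℝ) + 1 ≤ (n : ℝ) + 1 := by exact_mod_cast Nat.succ_le_succ (not_lt.1 hn)
      calc |(1 : ℝ)| * ((n : ℝ) + 1) ^ α = ((n : ℝ) + 1) ^ (-(β - α)) * ((n : ℝ) + 1) ^ β := by
            rw [abs_one, one_mul, ← Real.rpow_add (by positivity)]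
            ring_nf
        _ ≤ _ := mul_le_mul_of_nonneg_right
            (Real.rpow_le_rpow_of_nonpos (by positivity) hNn (by linarith)) (by positivity)
  have htail : inclCLM h - truncCLM α β N = compCLM (σ := id) Function.injective_id.injOn hc := by
    refine ContinuousLinearMap.ext fun v => WeightedSeq.ext fun n => ?_
    rw [_root_.sub_apply, sub_apply, inclCLM_apply, truncCLM_apply, compCLM_apply]
    split_ifs <;> simp
  exact htail ▸ norm_compCLM_le _ hc

theorem isCompactOperator_inclCLM (h : α < β) : IsCompactOperator (inclCLM h.le) := by
  have hlim : Tendsto (fun N : ℕ => ((N : ℝ) + 1) ^ (-(β - α))) atTop (𝓝 0) :=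
    (tendsto_rpow_neg_atTop (sub_pos.2 h)).comp
      (tendsto_atTop_add_const_right atTop (1 : ℝ) tendsto_natCast_atTop_atTop)
  refine isCompactOperator_of_tendsto (l := atTop) (F := truncCLM α β) ?_
    (Eventually.of_forall isCompactOperator_truncCLM)
  refine tendsto_iff_norm_sub_tendsto_zero.2 (squeeze_zero (fun _ => norm_nonneg _) (fun N => ?_)
    hlim)
  exact (norm_sub_rev _ _).trans_le (norm_inclCLM_sub_truncCLM_le h.le N)

end WeightedSeq

/-- The Jacobi operator with the diagonal `a` and the off-diagonal `c` (that is, the infinite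
symmetric tridiagonal matrix with these entries) acting on all sequences. -/
def jacobi (a c : ℕ → ℝ) : (ℕ → ℝ) →ₗ[ℝ] ℕ → ℝ where
  toFun v
    | 0 => a 0 * v 0 + c 0 * v 1
    | n + 1 => a (n + 1) * v (n + 1) + c n * v n + c (n + 1) * v (n + 2)
  map_add' v w := by
    funext n
    cases n <;> simp only [Pi.add_apply] <;> ring
  map_smul' x v := by
    funext n
    cases n <;> simp only [Pi.smul_apply, smul_eq_mul, RingHom.id_apply] <;> ring

section Jacobi

variable {a c v w : ℕ → ℝ}

theorem jacobi_zero (a c v : ℕ → ℝ) : jacobi a c v 0 = a 0 * v 0 + c 0 * v 1 := rfl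

theorem jacobi_succ (a c v : ℕ → ℝ) (n : ℕ) : jacobi a c v (n + 1) =
    a (n + 1) * v (n + 1) + c n * v n + c (n + 1) * v (n + 2) := rfl

theorem jacobi_add_diag_apply (d a c v : ℕ → ℝ) (n : ℕ) :
    jacobi (fun n => d n + a n) c v n = d n * v n + jacobi a c v n := by
  cases n <;> simp only [jacobi_zero, jacobi_succ] <;> ring

theorem jacobi_neg_apply (a c v : ℕ → ℝ) (n : ℕ) :
    jacobi (fun n => -a n) (fun n => -c n) v n = -jacobi a c v n := by
  cases n <;> simp only [jacobi_zero, jacobi_succ] <;> ring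

theorem mul_jacobi_mul (ρ a c v : ℕ → ℝ) (n : ℕ) :
    ρ n * jacobi a c (fun n => ρ n * v n) n =
      jacobi (fun n => ρ n ^ 2 * a n) (fun n => ρ n * ρ (n + 1) * c n) v n := by
  cases n <;> simp only [jacobi_zero, jacobi_succ] <;> ring

theorem eq_zero_of_jacobi_eq_zero (hc : ∀ n, c n ≠ 0) (hv : jacobi a c v = 0) (h0 : v 0 = 0) :
    v = 0 := by
  have key (n : ℕ) : v n = 0 ∧ v (n + 1) = 0 := by
    induction n with
    | zero =>
      have h := congrFun hv 0
      rw [jacobi_zero, h0, mul_zero, zero_add] at h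
      exact ⟨h0, (mul_eq_zero.1 h).resolve_left (hc 0)⟩
    | succ n ih =>
      have h := congrFun hv (n + 1)
      rw [jacobi_succ, ih.1, ih.2, mul_zero, mul_zero, add_zero, zero_add] at h
      exact ⟨ih.2, (mul_eq_zero.1 h).resolve_left (hc (n + 1))⟩
  exact funext fun n => (key n).1

theorem sum_range_mul_jacobi_sub (a c v w : ℕ → ℝ) (N : ℕ) :
    ∑ n ∈ Finset.range (N + 1), (v n * jacobi a c w n - jacobi a c v n * w n) =
      c N * (v N * w (N + 1) - v (N + 1) * w N) := by
  induction N with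
  | zero => rw [Finset.sum_range_one, jacobi_zero, jacobi_zero]; ring
  | succ N ih => rw [Finset.sum_range_succ, ih, jacobi_succ, jacobi_succ]; ring

/-- At an index where `|w|` is maximal, the eigenvalue equation bounds `|μ|` by the row sum. -/
theorem abs_le_of_jacobi_eq_smul {R μ : ℝ} (hR0 : |a 0| + |c 0| ≤ R)
    (hR : ∀ n, |a (n + 1)| + |c n| + |c (n + 1)| ≤ R) (hw : Tendsto w atTop (𝓝 0)) (hw0 : w ≠ 0)
    (h : jacobi a c w = μ • w) : |μ| ≤ R := by
  obtain ⟨i, hi⟩ := Function.ne_iff.1 hw0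
  have hlim : Tendsto (fun n => |w n|) (cocompact ℕ) (𝓝 0) := by
    rw [cocompact_eq_cofinite, Nat.cofinite_eq_atTop]
    simpa using hw.abs
  obtain ⟨j, hj⟩ := (continuous_of_discreteTopology (f := fun n => |w n|)).exists_forall_ge'
    i (hlim.eventually_le_const (abs_pos.2 hi))
  have hjpos : 0 < |w j| := (abs_pos.2 hi).trans_le (hj i)
  have hterm (x : ℝ) (n : ℕ) : |x * w n| ≤ |x| * |w j| :=
    (abs_mul _ _).trans_le (mul_le_mul_of_nonneg_left (hj n) (abs_nonneg x))
  have hrow : |jacobi a c w j| ≤ R * |w j| := by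
    cases j with
    | zero =>
      refine (abs_add_le _ _).trans ((add_le_add (hterm _ _) (hterm _ _)).trans ?_)
      rw [← add_mul]
      exact mul_le_mul_of_nonneg_right hR0 hjpos.le
    | succ j =>
      refine (abs_add_three _ _ _).trans
        ((add_le_add_three (hterm _ _) (hterm _ _) (hterm _ _)).trans ?_)
      rw [← add_mul, ← add_mul]
      exact mul_le_mul_of_nonneg_right (hR j) hjpos.le
  rw [h, Pi.smul_apply, smul_eq_mul, abs_mul] at hrow
  exact le_of_mul_le_mul_right hrow hjpos

/-- If `u` is nonnegative up to `n`, its flux `b n * (u (n + 1) - u n)` is not below the initial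
value `-q * u 0`, so that the total decrease is at most `q * u 0 * ∑ (b i)⁻¹`. -/
theorem le_of_flux_monotone {b u : ℕ → ℝ} {q θ : ℝ} (hb : ∀ n, 0 < b n) (hθ : θ ≤ 1)
    (hsum : ∀ n, q * ∑ i ∈ Finset.range n, (b i)⁻¹ ≤ θ) (hu0 : 0 ≤ u 0)
    (hflux0 : -(q * u 0) ≤ b 0 * (u 1 - u 0))
    (hflux : ∀ n, 0 ≤ u (n + 1) → b n * (u (n + 1) - u n) ≤ b (n + 1) * (u (n + 2) - u (n + 1)))
    (n : ℕ) : (1 - θ) * u 0 ≤ u n := by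
  have hle (n : ℕ) : (1 - θ) * u 0 ≤ u 0 * (1 - q * ∑ i ∈ Finset.range n, (b i)⁻¹) := by
    nlinarith [hsum n]
  suffices key : ∀ n, u 0 * (1 - q * ∑ i ∈ Finset.range n, (b i)⁻¹) ≤ u n ∧
      -(q * u 0) ≤ b n * (u (n + 1) - u n) from (hle n).trans (key n).1
  intro n
  induction n with
  | zero => exact ⟨by simp, hflux0⟩
  | succ n ih =>
    have hdecr : -(q * u 0) * (b n)⁻¹ ≤ u (n + 1) - u n := by
      rw [← div_eq_mul_inv, div_le_iff₀' (hb n)]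
      exact ih.2
    have hstep : u 0 * (1 - q * ∑ i ∈ Finset.range (n + 1), (b i)⁻¹) ≤ u (n + 1) := by
      rw [Finset.sum_range_succ]
      linarith [ih.1]
    have hnonneg : 0 ≤ u (n + 1) :=
      (mul_nonneg (sub_nonneg.2 hθ) hu0).trans ((hle (n + 1)).trans hstep)
    exact ⟨hstep, ih.2.trans (hflux n hnonneg)⟩

end Jacobi

namespace WeightedSeq

variable {α β r : ℝ} {a c : ℕ → ℝ}

/-- A Jacobi operator with entries of growth `r`, as a bounded operator `h^β → h^α`. -/
noncomputable def jacobiCLM (ha : HasGrowth r a) (hc : HasGrowth r c) (h : α + r ≤ β) :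
    WeightedSeq β →L[ℝ] WeightedSeq α :=
  mulCLM ha h + shiftRight α ∘L mulCLM hc h + mulCLM hc h ∘L shiftLeft β

@[simp] theorem jacobiCLM_apply (ha : HasGrowth r a) (hc : HasGrowth r c) (h : α + r ≤ β)
    (v : WeightedSeq β) (n : ℕ) : jacobiCLM ha hc h v n = jacobi a c v n := by
  cases n <;> simp [jacobiCLM, jacobi_zero, jacobi_succ, -map_add]

theorem isCompactOperator_jacobiCLM (ha : HasGrowth r a) (hc : HasGrowth r c) (h : α + r < β) :
    IsCompactOperator (jacobiCLM ha hc h.le) := by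
  have hfactor : jacobiCLM ha hc h.le =
      inclCLM (lt_sub_iff_add_lt.2 h).le ∘L jacobiCLM ha hc (sub_add_cancel β r).le :=
    ContinuousLinearMap.ext fun v => WeightedSeq.ext fun n => by simp
  exact hfactor ▸ (isCompactOperator_inclCLM (lt_sub_iff_add_lt.2 h)).comp_clm _

end WeightedSeq

section JacobiPairing

variable {α β r s t : ℝ} {a c v w : ℕ → ℝ}

theorem jacobi_mem (ha : HasGrowth r a) (hc : HasGrowth r c) (h : α + r ≤ β)
    (hv : v ∈ hSubmodule β) : jacobi a c v ∈ hSubmodule α := by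
  have hJ : WeightedSeq.toSeq α (WeightedSeq.jacobiCLM ha hc h (.mk v hv)) = jacobi a c v :=
    funext fun n => WeightedSeq.jacobiCLM_apply ha hc h _ n
  exact hJ ▸ WeightedSeq.mem _

theorem summable_mul_jacobi (ha : HasGrowth r a) (hc : HasGrowth r c) (h : r ≤ s + t)
    (hv : v ∈ hSubmodule s) (hw : w ∈ hSubmodule t) : Summable fun n => v n * jacobi a c w n :=
  summable_mul_of_mem (by linarith) hv (jacobi_mem ha hc (sub_add_cancel t r).le hw)

theorem tsum_mul_jacobi (ha : HasGrowth r a) (hc : HasGrowth r c) (h : r ≤ s + t)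
    (hv : v ∈ hSubmodule s) (hw : w ∈ hSubmodule t) :
    ∑' n, v n * jacobi a c w n = ∑' n, w n * jacobi a c v n := by
  have hvw := summable_mul_jacobi ha hc h hv hw
  have hwv := summable_mul_jacobi ha hc (h.trans_eq (add_comm s t)) hw hv
  have hbdry : Tendsto (fun n => c n * (v n * w (n + 1) - v (n + 1) * w n)) atTop (𝓝 0) := by
    have h1 := (summable_mul_of_mem (s := s - r) (by linarith)
      (hc.mul_mem (sub_add_cancel s r).le hv) (comp_succ_mem hw)).tendsto_atTop_zero
    have h2 := (summable_mul_of_mem (t := t - r) (by linarith)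
      (comp_succ_mem hv) (hc.mul_mem (sub_add_cancel t r).le hw)).tendsto_atTop_zero
    convert h1.sub h2 using 2 <;> ring
  have hpart := ((hvw.hasSum.sub hwv.hasSum).tendsto_sum_nat).comp (tendsto_add_atTop_nat 1)
  refine sub_eq_zero.1 (tendsto_nhds_unique hpart (hbdry.congr fun N => ?_))
  simp only [Function.comp_apply, ← sum_range_mul_jacobi_sub a c v w N, mul_comm (w _)]

end JacobiPairing

/-- The order isomorphism with `ℕ` comes from counting the larger elements. -/
theorem exists_strictAnti_range_eq {S : Set ℝ} (hpos : ∀ x ∈ S, 0 < x) (hinf : S.Infinite)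
    (hfin : ∀ ε > 0, {x ∈ S | ε ≤ x}.Finite) :
    ∃ m : ℕ → ℝ, StrictAnti m ∧ Set.range m = S ∧ Tendsto m atTop (𝓝 0) := by
  let count (x : Sᵒᵈ) : ℕ := {y ∈ S | (x.ofDual : ℝ) < y}.ncard
  have hcount : StrictMono count := fun x y hxy => by
    refine Set.ncard_lt_ncard ⟨fun z hz => ⟨hz.1, lt_trans hxy hz.2⟩, fun h => ?_⟩
      ((hfin _ (hpos _ y.ofDual.2)).subset fun z hz => ⟨hz.1, hz.2.le⟩)
    exact lt_irrefl _ (h ⟨x.ofDual.2, hxy⟩).2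
  have : Infinite Sᵒᵈ := hinf.to_subtype
  have : Infinite (Set.range count) := Set.infinite_coe_iff.2
    (Set.infinite_range_of_injective hcount.injective)
  classical
  let e : ℕ ≃o Sᵒᵈ := (Nat.Subtype.orderIsoOfNat _).trans (hcount.orderIso count).symm
  let m (n : ℕ) : ℝ := (e n).ofDual
  have hanti : StrictAnti m := fun i j hij => e.strictMono hij
  refine ⟨m, hanti, ?_, ?_⟩
  · refine (Set.range_comp Subtype.val fun n => (e n).ofDual).trans ?_
    rw [(show Function.Surjective fun n => (e n).ofDual from e.surjective).range_eq,
      Set.image_univ, Subtype.range_coe]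
  · refine tendsto_order.2 ⟨fun a ha => .of_forall fun n => ha.trans (hpos _ (e n).ofDual.2),
      fun ε hε => ?_⟩
    rw [← Nat.cofinite_eq_atTop]
    refine ((hfin ε hε).preimage hanti.injective.injOn).subset fun n hn => ?_
    exact ⟨(e n).ofDual.2, not_lt.1 hn⟩

section CompactOperator

open Module.End

theorem exists_norm_apply_sub_apply_lt {E F : Type*} [NormedAddCommGroup E] [NormedSpace ℝ E]
    [NormedAddCommGroup F] [NormedSpace ℝ F] {T : E →L[ℝ] F} (hT : IsCompactOperator T)
    {x : ℕ → E} {r ε : ℝ} (hx : ∀ n, ‖x n‖ ≤ r) (hε : 0 < ε) :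
    ∃ i j, i ≠ j ∧ ‖T (x i) - T (x j)‖ < ε := by
  obtain ⟨K, hK, hK'⟩ := hT.image_closedBall_subset_compact r
  obtain ⟨y, -, ψ, hψ, hlim⟩ := hK.tendsto_subseq (x := fun n => T (x n))
    fun n => hK' ⟨x n, mem_closedBall_zero_iff.2 (hx n), rfl⟩
  obtain ⟨N, hN⟩ := Metric.cauchySeq_iff'.1 hlim.cauchySeq ε hε
  refine ⟨ψ (N + 1), ψ N, hψ.injective.ne N.succ_ne_self, ?_⟩
  rw [← dist_eq_norm]
  exact hN (N + 1) N.le_succ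

variable {H : Type*} [NormedAddCommGroup H] [InnerProductSpace ℝ H] {T : H →L[ℝ] H}

theorem finite_setOf_hasEigenvalue_ge (hT : IsCompactOperator T) (hT' : T.IsSymmetric) {ε : ℝ}
    (hε : 0 < ε) : {μ | HasEigenvalue (T : Module.End ℝ H) μ ∧ ε ≤ μ}.Finite := by
  by_contra hinf
  let f := Set.Infinite.natEmbedding _ hinf
  have hunit (n : ℕ) : ∃ x : H, ‖x‖ = 1 ∧ T x = (f n : ℝ) • x := by
    obtain ⟨x, hx⟩ := (f n).2.1.exists_hasEigenvector
    have hTx : T x = (f n : ℝ) • x := hx.apply_eq_smul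
    refine ⟨‖x‖⁻¹ • x, ?_, by rw [map_smul, hTx, smul_comm]⟩
    rw [norm_smul, norm_inv, norm_norm, inv_mul_cancel₀ (norm_ne_zero_iff.2 hx.2)]
  choose x hx1 hxT using hunit
  obtain ⟨i, j, hij, hlt⟩ := exists_norm_apply_sub_apply_lt hT (fun n => (hx1 n).le) hε
  have hne : (f i : ℝ) ≠ f j := fun h => hij (f.injective (Subtype.ext h))
  have horth : inner ℝ (x i) (x j) = 0 :=
    hT'.orthogonalFamily_eigenspaces hne ⟨x i, mem_eigenspace_iff.2 (hxT i)⟩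
      ⟨x j, mem_eigenspace_iff.2 (hxT j)⟩
  have hpyth := norm_sub_sq_eq_norm_sq_add_norm_sq_real
    (show inner ℝ (T (x i)) (T (x j)) = 0 by
      rw [hxT, hxT, real_inner_smul_left, real_inner_smul_right, horth, mul_zero, mul_zero])
  have hnorm : ‖T (x i)‖ = f i := by
    rw [hxT, norm_smul, hx1, mul_one, Real.norm_of_nonneg (hε.le.trans (f i).2.2)]
  nlinarith [(f i).2.2, norm_nonneg (T (x i) - T (x j)), norm_nonneg (T (x j))]

theorem infinite_setOf_hasEigenvalue [CompleteSpace H] (hT : IsCompactOperator T)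
    (hT' : T.IsSymmetric) (h0 : ¬ HasEigenvalue (T : Module.End ℝ H) 0)
    (hH : ¬ FiniteDimensional ℝ H) : {μ | HasEigenvalue (T : Module.End ℝ H) μ}.Infinite := by
  intro hfin
  have hfd (μ : ℝ) : FiniteDimensional ℝ (eigenspace (T : Module.End ℝ H) μ) := by
    by_cases hμ : μ = 0
    · rw [hμ, not_not.1 (hasEigenvalue_iff.not.1 h0)]
      infer_instance
    · exact ContinuousLinearMap.finite_dimensional_eigenspace hT μ hμ
  have hle : (⨆ μ, eigenspace (T : Module.End ℝ H) μ) ≤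
      hfin.toFinset.sup fun μ => eigenspace (T : Module.End ℝ H) μ := iSup_le fun μ => by
    by_cases hμ : HasEigenvalue (T : Module.End ℝ H) μ
    · exact Finset.le_sup (f := fun μ => eigenspace (T : Module.End ℝ H) μ)
        (hfin.mem_toFinset.2 hμ)
    · exact (not_not.1 (hasEigenvalue_iff.not.1 hμ)).trans_le bot_le
  have hsup := Submodule.finiteDimensional_of_le hle
  rw [Submodule.orthogonal_eq_bot_iff.1
    (ContinuousLinearMap.orthogonalComplement_iSup_eigenspaces_eq_bot hT hT')] at hsup
  exact hH (Module.Finite.equiv Submodule.topEquiv)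

end CompactOperator

theorem not_finiteDimensional_ellTwo : ¬ FiniteDimensional ℝ (lp (fun _ : ℕ => ℝ) 2) := by
  intro h
  have hv : Orthonormal ℝ fun i : ℕ => lp.single (E := fun _ : ℕ => ℝ) 2 i (1 : ℝ) := by
    rw [orthonormal_iff_ite]
    intro i j
    rw [lp.inner_single_left, lp.single_apply]
    by_cases hij : i = j
    · subst hij; simp
    · simp [hij]
  exact not_finite_iff_infinite.2 inferInstance hv.linearIndependent.finite

section Fredholm

variable {E F : Type*} [NormedAddCommGroup E] [NormedSpace ℝ E] [NormedAddCommGroup F]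
  [NormedSpace ℝ F] {A G : E →L[ℝ] F}

theorem isInvertible_add_of_isCompactOperator [CompleteSpace E] [CompleteSpace F]
    (hA : A.IsInvertible) (hG : IsCompactOperator G) (hker : ∀ x, A x + G x = 0 → x = 0) :
    (A + G).IsInvertible := by
  obtain ⟨D, rfl⟩ := hA
  let T : F →L[ℝ] F := -(G ∘L (D.symm : F →L[ℝ] E))
  have hT : IsCompactOperator T := (hG.comp_clm _).neg
  have hTD (x : E) : T (D x) = -G x := congrArg (-G ·) (D.symm_apply_apply x)
  rcases hT.hasEigenvalue_or_mem_resolventSet one_ne_zero with h | h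
  · obtain ⟨f, hf⟩ := h.exists_hasEigenvector
    have hTf : T f = f := hf.apply_eq_smul.trans (one_smul ℝ f)
    have hGf := hTD (D.symm f)
    rw [D.apply_symm_apply, hTf] at hGf
    have h0 := hker (D.symm f) (by
      rw [ContinuousLinearEquiv.coe_coe, D.apply_symm_apply, ← eq_neg_iff_add_eq_zero, ← hGf])
    exact absurd (D.symm.map_eq_zero_iff.1 h0) hf.2
  · obtain ⟨u, hu⟩ := spectrum.mem_resolventSet_iff.1 h
    have hcomp : (D : E →L[ℝ] F) + G = (u : F →L[ℝ] F) ∘L (D : E →L[ℝ] F) := by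
      ext x
      rw [hu, map_one, ContinuousLinearMap.comp_apply, _root_.sub_apply,
        ContinuousLinearEquiv.coe_coe, hTD, one_apply_eq_self, sub_neg_eq_add]
      rfl
    rw [hcomp]
    exact .comp ⟨ContinuousLinearEquiv.ofUnit u, rfl⟩ ⟨D, rfl⟩

open scoped LinearMap.FiniteRangeSetoid in
theorem isFredholm_of_isInvertible_add (h : (A + G).IsInvertible)
    (hG : (G : E →ₗ[ℝ] F).HasNoetherianRange) : A.IsFredholm := by
  obtain ⟨e, he⟩ := h
  refine .of_isQuasiInverse (v := (e.symm : F →L[ℝ] E))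
    (e.toLinearEquiv.isQuasiInverse.congr (Setoid.refl _) ?_)
  rw [LinearMap.FiniteRangeSetoid.equiv_iff_hasNoetherianRange]
  have hsub : (A : E →ₗ[ℝ] F) - (e.toLinearEquiv : E →ₗ[ℝ] F) = (-1 : ℝ) • (G : E →ₗ[ℝ] F) := by
    ext x
    have hx : e x = A x + G x := DFunLike.congr_fun he x
    simp [hx]
  rw [hsub]
  exact hG.smul _

theorem isFredholmOfIndexZero_of_isInvertible (hA : A.IsInvertible) :
    IsFredholmOfIndexZero A := by
  refine ⟨isFredholm_of_isInvertible_add (G := 0) (by rwa [add_zero]) .zero, ?_⟩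
  rw [LinearMap.ker_eq_bot.2 hA.injective, LinearMap.range_eq_top.2 hA.surjective,
    finrank_bot, Module.finrank_zero_of_subsingleton, sub_self]

section Bordered

variable {φ : E →L[ℝ] ℝ} {e : F}

theorem finrank_ker_of_isInvertible_add_smulRight (h : (A + φ.smulRight e).IsInvertible)
    (he : e ∉ A.range) : Module.finrank ℝ A.ker = 1 := by
  obtain ⟨z, hz⟩ := h.surjective e
  have hz : A z + φ z • e = e := hz
  have hφz : φ z = 1 := by
    by_contra hne
    have hmem : (1 - φ z) • e ∈ A.range := ⟨z, by
      rw [sub_smul, one_smul]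
      exact eq_sub_of_add_eq hz⟩
    exact he ((Submodule.smul_mem_iff _ (sub_ne_zero.2 (Ne.symm hne))).1 hmem)
  have hAz : A z = 0 := by rwa [hφz, one_smul, add_eq_right] at hz
  refine finrank_eq_one ⟨z, hAz⟩ (fun h0 => ?_) fun x => ⟨φ x, Subtype.ext (h.injective ?_)⟩
  · rw [show z = 0 from congrArg Subtype.val h0, map_zero] at hφz
    exact zero_ne_one hφz
  · have hx : A x = 0 := x.2
    change A (φ x • z) + φ (φ x • z) • e = A x + φ x • e
    rw [map_smul, map_smul, hAz, hφz, hx, smul_zero, smul_eq_mul, mul_one]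

theorem finrank_quotient_range_of_isInvertible_add_smulRight
    (h : (A + φ.smulRight e).IsInvertible) (he : e ∉ A.range) :
    Module.finrank ℝ (F ⧸ A.range) = 1 := by
  refine finrank_eq_one (Submodule.Quotient.mk e)
    (fun h0 => he ((Submodule.Quotient.mk_eq_zero _).1 h0)) fun q => ?_
  obtain ⟨f, rfl⟩ := Submodule.Quotient.mk_surjective _ q
  obtain ⟨y, rfl⟩ := h.surjective f
  refine ⟨φ y, ?_⟩
  rw [← Submodule.Quotient.mk_smul, Submodule.Quotient.eq]
  refine ⟨-y, ?_⟩
  change A (-y) = φ y • e - (A y + φ y • e)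
  rw [map_neg, sub_add_cancel_right]

theorem isFredholmOfIndexZero_of_isInvertible_add_smulRight
    (h : (A + φ.smulRight e).IsInvertible) (he : e ∉ A.range) : IsFredholmOfIndexZero A := by
  refine ⟨isFredholm_of_isInvertible_add h
    ((LinearMap.HasNoetherianRange.of_isNoetherian_rng (f := (φ : E →ₗ[ℝ] ℝ))).comp_left
      (LinearMap.toSpanSingleton ℝ F e)), ?_⟩
  rw [finrank_ker_of_isInvertible_add_smulRight h he,
    finrank_quotient_range_of_isInvertible_add_smulRight h he, sub_self]

end Bordered

end Fredholm

/-- The eigenvalues of the Jacobi operator with the entries `a` and `c` on `ℓ²`. -/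
def jacobiEigenvalues (a c : ℕ → ℝ) : Set ℝ :=
  {μ | ∃ w ∈ hSubmodule 0, w ≠ 0 ∧ jacobi a c w = μ • w}

/-- A Jacobi operator with bounded entries, as an operator on the Hilbert space `ℓ²`. -/
noncomputable def jacobiEllTwo {r : ℝ} {a c : ℕ → ℝ} (ha : HasGrowth r a) (hc : HasGrowth r c)
    (hr : r ≤ 0) : lp (fun _ : ℕ => ℝ) 2 →L[ℝ] lp (fun _ : ℕ => ℝ) 2 :=
  ((WeightedSeq.toLpEquiv 0).toContinuousLinearEquiv : WeightedSeq 0 →L[ℝ] _) ∘L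
    WeightedSeq.jacobiCLM ha hc ((zero_add r).trans_le hr) ∘L
      ((WeightedSeq.toLpEquiv 0).symm.toContinuousLinearEquiv : _ →L[ℝ] WeightedSeq 0)

section JacobiSpectrum

variable {r μ : ℝ} {a c : ℕ → ℝ}

theorem jacobiEllTwo_toLpEquiv (ha : HasGrowth r a) (hc : HasGrowth r c) (hr : r ≤ 0)
    (v : WeightedSeq 0) : jacobiEllTwo ha hc hr (WeightedSeq.toLpEquiv 0 v) =
      WeightedSeq.toLpEquiv 0 (WeightedSeq.jacobiCLM ha hc ((zero_add r).trans_le hr) v) := by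
  simp [jacobiEllTwo]

theorem isCompactOperator_jacobiEllTwo (ha : HasGrowth r a) (hc : HasGrowth r c) (hr : r < 0) :
    IsCompactOperator (jacobiEllTwo ha hc hr.le) := by
  have h := WeightedSeq.isCompactOperator_jacobiCLM ha hc ((zero_add r).trans_lt hr)
  simpa only [jacobiEllTwo, ContinuousLinearMap.coe_comp] using (h.comp_clm _).clm_comp _

theorem isSymmetric_jacobiEllTwo (ha : HasGrowth r a) (hc : HasGrowth r c) (hr : r ≤ 0) :
    (jacobiEllTwo ha hc hr).IsSymmetric := by
  intro x y
  obtain ⟨v, rfl⟩ := (WeightedSeq.toLpEquiv 0).surjective x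
  obtain ⟨w, rfl⟩ := (WeightedSeq.toLpEquiv 0).surjective y
  have h := tsum_mul_jacobi ha hc (by linarith) v.mem w.mem
  simpa [jacobiEllTwo_toLpEquiv, lp.inner_eq_tsum, WeightedSeq.toLpEquiv_apply, mul_comm]
    using h.symm

theorem hasEigenvalue_jacobiEllTwo (ha : HasGrowth r a) (hc : HasGrowth r c) (hr : r ≤ 0) :
    Module.End.HasEigenvalue (jacobiEllTwo ha hc hr : Module.End ℝ (lp (fun _ : ℕ => ℝ) 2)) μ ↔
      μ ∈ jacobiEigenvalues a c := by
  have key (v : WeightedSeq 0) : jacobiEllTwo ha hc hr (WeightedSeq.toLpEquiv 0 v) =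
      μ • WeightedSeq.toLpEquiv 0 v ↔ jacobi a c v = μ • (v : ℕ → ℝ) := by
    rw [jacobiEllTwo_toLpEquiv, ← map_smul, (WeightedSeq.toLpEquiv 0).injective.eq_iff,
      ← (WeightedSeq.toSeq_injective 0).eq_iff, map_smul]
    exact Eq.congr_left (funext fun n => (WeightedSeq.jacobiCLM_apply _ _ _ _ n))
  constructor
  · intro h
    obtain ⟨u, hu⟩ := h.exists_hasEigenvector
    obtain ⟨v, rfl⟩ := (WeightedSeq.toLpEquiv 0).surjective u
    refine ⟨v, v.mem, fun hv => hu.2 ?_, (key v).1 hu.apply_eq_smul⟩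
    rw [WeightedSeq.toSeq_injective 0 (hv.trans (map_zero _).symm), map_zero]
  · rintro ⟨w, hw, hw0, h⟩
    refine Module.End.hasEigenvalue_of_hasEigenvector
      (x := WeightedSeq.toLpEquiv 0 (WeightedSeq.mk w hw))
      ⟨Module.End.mem_eigenspace_iff.2 ((key _).2 h), fun hz => hw0 ?_⟩
    rw [LinearIsometryEquiv.map_eq_zero_iff] at hz
    exact congrArg (WeightedSeq.toSeq 0) hz

theorem exists_strictAnti_range_eq_jacobiEigenvalues (ha : HasGrowth r a) (hc : HasGrowth r c)
    (hr : r < 0) (hpos : ∀ μ ∈ jacobiEigenvalues a c, 0 < μ) :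
    ∃ m : ℕ → ℝ, StrictAnti m ∧ Set.range m = jacobiEigenvalues a c ∧ Tendsto m atTop (𝓝 0) := by
  have hcompact := isCompactOperator_jacobiEllTwo ha hc hr
  have hsymm := isSymmetric_jacobiEllTwo ha hc hr.le
  refine exists_strictAnti_range_eq hpos ?_ fun ε hε => ?_
  · have hinf := infinite_setOf_hasEigenvalue hcompact hsymm
      (fun h => (hpos 0 ((hasEigenvalue_jacobiEllTwo ha hc hr.le).1 h)).false)
      not_finiteDimensional_ellTwo
    simpa only [hasEigenvalue_jacobiEllTwo] using! hinf
  · simpa only [hasEigenvalue_jacobiEllTwo] using finite_setOf_hasEigenvalue_ge hcompact hsymm hε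

end JacobiSpectrum

/-- The factor `(2 k - 1) (2 k + 2)` of `μ` in `A_k(μ)`, with `k = n + 1`. -/
noncomputable def diagWeight (n : ℕ) : ℝ := (2 * n + 1) * (2 * n + 4)

/-- The numbers `√(4 k + 1)`, with `k = n + 1`. The substitution `v n = normFactor n * u n` turns
`𝒜(0)` into a second order difference operator in divergence form. -/
noncomputable def normFactor (n : ℕ) : ℝ := √(4 * n + 5)

/-- The conductances of the difference operator in divergence form to which `𝒜(0)` is conjugate
under `normFactor`: its flux is `bond n * (u (n + 1) - u n)`. -/
noncomputable def bond (n : ℕ) : ℝ :=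
  (2 * n + 1) * (2 * n + 3) * (2 * n + 4) / (4 * n + 7)

section Coefficients

variable {μ : ℝ} {v : ℕ → ℝ}

theorem diagWeight_pos (n : ℕ) : 0 < diagWeight n := by unfold diagWeight; positivity

theorem sq_le_diagWeight (n : ℕ) : ((n : ℝ) + 1) ^ 2 ≤ diagWeight n := by
  unfold diagWeight
  nlinarith [n.cast_nonneg (α := ℝ)]

theorem bond_pos (n : ℕ) : 0 < bond n := by unfold bond; positivity

theorem bond_le (n : ℕ) : bond n ≤ 3 * ((n : ℝ) + 1) ^ 2 := by
  have hn : (0 : ℝ) ≤ n := n.cast_nonneg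
  rw [bond, div_le_iff₀ (by positivity)]
  nlinarith [pow_nonneg hn 2, pow_nonneg hn 3]

theorem sum_range_inv_bond_le_one (n : ℕ) : ∑ i ∈ Finset.range n, (bond i)⁻¹ ≤ 1 := by
  suffices key : ∑ i ∈ Finset.range n, (bond i)⁻¹ ≤ 1 - (2 * (n : ℝ) + 1)⁻¹ from
    key.trans (sub_le_self _ (by positivity))
  induction n with
  | zero => simp
  | succ n ih =>
    have hn : (0 : ℝ) ≤ n := n.cast_nonneg
    have hterm : (bond n)⁻¹ ≤ (2 * (n : ℝ) + 1)⁻¹ - (2 * (n + 1 : ℕ) + 1 : ℝ)⁻¹ := by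
      rw [bond, inv_div, inv_sub_inv (by positivity) (by positivity),
        div_le_div_iff₀ (by positivity) (by positivity)]
      push_cast
      nlinarith [pow_nonneg hn 2, pow_nonneg hn 3, pow_nonneg hn 4]
    rw [Finset.sum_range_succ]
    linarith

theorem normFactor_sq (n : ℕ) : normFactor n ^ 2 = 4 * n + 5 := Real.sq_sqrt (by positivity)

theorem one_le_normFactor (n : ℕ) : 1 ≤ normFactor n :=
  Real.one_le_sqrt.2 (by linarith [n.cast_nonneg (α := ℝ)])

theorem normFactor_pos (n : ℕ) : 0 < normFactor n := zero_lt_one.trans_le (one_le_normFactor n)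

theorem normFactor_mul_coeffC (n : ℕ) :
    normFactor n * normFactor (n + 1) * coeffC (n + 1) = bond n := by
  have hroot : √((4 * ((n + 1 : ℕ) : ℝ) + 5) / (4 * ((n + 1 : ℕ) : ℝ) + 1)) =
      normFactor (n + 1) / normFactor n := by
    rw [Real.sqrt_div (by positivity), normFactor, normFactor]
    congr 2
    push_cast
    ring
  have hsq := normFactor_sq (n + 1)
  have hne := (normFactor_pos n).ne'
  rw [coeffC, hroot, bond]
  push_cast at hsq ⊢
  field_simp
  rw [hsq]
  ring

theorem normFactor_mul_coeffB (n : ℕ) :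
    normFactor n * normFactor (n + 1) * coeffB (n + 2) = bond n := by
  have hroot : √((4 * ((n + 2 : ℕ) : ℝ) - 3) / (4 * ((n + 2 : ℕ) : ℝ) + 1)) =
      normFactor n / normFactor (n + 1) := by
    rw [Real.sqrt_div (by push_cast; linarith [n.cast_nonneg (α := ℝ)]), normFactor, normFactor]
    congr 2 <;> push_cast <;> ring
  have hden : (4 * ((n + 2 : ℕ) : ℝ) - 3) * (4 * ((n + 2 : ℕ) : ℝ) - 1) =
      (4 * n + 5) * (4 * n + 7) := by push_cast; ring
  have hsq := normFactor_sq n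
  have hne := (normFactor_pos (n + 1)).ne'
  rw [coeffB, hroot, hden, bond]
  push_cast
  field_simp
  rw [hsq]
  ring

theorem coeffB_add_two (n : ℕ) : coeffB (n + 2) = coeffC (n + 1) :=
  mul_left_cancel₀ (mul_pos (normFactor_pos n) (normFactor_pos (n + 1))).ne'
    ((normFactor_mul_coeffB n).trans (normFactor_mul_coeffC n).symm)

theorem coeffC_pos (n : ℕ) : 0 < coeffC (n + 1) :=
  pos_of_mul_pos_right ((bond_pos n).trans_eq (normFactor_mul_coeffC n).symm)
    (mul_pos (normFactor_pos n) (normFactor_pos (n + 1))).le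

theorem coeffA_eq (μ : ℝ) (n : ℕ) : coeffA μ (n + 1) = μ * diagWeight n + coeffA 0 (n + 1) := by
  unfold coeffA diagWeight
  push_cast
  ring

theorem normFactor_sq_mul_coeffA_zero_one : normFactor 0 ^ 2 * coeffA 0 1 = 2 / 3 - bond 0 := by
  rw [normFactor_sq]
  norm_num [coeffA, bond]

theorem normFactor_sq_mul_coeffA_zero_add_two (n : ℕ) :
    normFactor (n + 1) ^ 2 * coeffA 0 (n + 2) = -(bond n + bond (n + 1)) := by
  have hminus : 4 * ((n + 2 : ℕ) : ℝ) - 1 = 4 * n + 7 := by push_cast; ring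
  rw [normFactor_sq, coeffA, bond, bond, hminus]
  push_cast
  field_simp
  ring

theorem seqOp_eq_jacobi (μ : ℝ) (v : ℕ → ℝ) :
    seqOp μ v = jacobi (fun n => coeffA μ (n + 1)) (fun n => coeffC (n + 1)) v := by
  funext n
  cases n with
  | zero => rfl
  | succ n => rw [seqOp, jacobi_succ, coeffB_add_two]

theorem seqOp_eq_add (μ : ℝ) (v : ℕ → ℝ) (n : ℕ) :
    seqOp μ v n = μ * diagWeight n * v n + seqOp 0 v n := by
  rw [seqOp_eq_jacobi, seqOp_eq_jacobi,
    ← jacobi_add_diag_apply (fun n => μ * diagWeight n) (fun n => coeffA 0 (n + 1))]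
  simp only [← coeffA_eq]

theorem hasGrowth_diagWeight : HasGrowth 2 diagWeight := by
  refine ⟨5, fun n => ?_⟩
  rw [abs_of_pos (diagWeight_pos n), Real.rpow_two, diagWeight]
  nlinarith [n.cast_nonneg (α := ℝ)]

theorem hasGrowth_inv_diagWeight : HasGrowth (-2) fun n => (diagWeight n)⁻¹ := by
  refine ⟨1, fun n => ?_⟩
  rw [abs_of_pos (inv_pos.2 (diagWeight_pos n)), Real.rpow_neg (by positivity), Real.rpow_two,
    one_mul]
  exact inv_anti₀ (by positivity) (sq_le_diagWeight n)

theorem hasGrowth_coeffC : HasGrowth 1 fun n => coeffC (n + 1) := by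
  refine ⟨3, fun n => ?_⟩
  have hprod : (n : ℝ) + 1 ≤ normFactor n * normFactor (n + 1) := by
    refine le_of_sq_le_sq ?_ (mul_pos (normFactor_pos n) (normFactor_pos _)).le
    rw [mul_pow, normFactor_sq, normFactor_sq]
    push_cast
    nlinarith [n.cast_nonneg (α := ℝ)]
  rw [abs_of_pos (coeffC_pos n), Real.rpow_one]
  nlinarith [normFactor_mul_coeffC n, bond_le n, mul_le_mul_of_nonneg_right hprod (coeffC_pos n).le]

theorem hasGrowth_coeffA_zero : HasGrowth 1 fun n => coeffA 0 (n + 1) := by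
  refine ⟨5, fun n => ?_⟩
  rw [Real.rpow_one]
  cases n with
  | zero => norm_num [coeffA, abs_le]
  | succ n =>
    have h := normFactor_sq_mul_coeffA_zero_add_two n
    have hb := bond_le (n + 1)
    rw [normFactor_sq] at h
    push_cast at h hb ⊢
    rw [abs_le]
    constructor <;>
    nlinarith [bond_pos n, bond_pos (n + 1), bond_le n, n.cast_nonneg (α := ℝ)]

theorem eq_zero_of_seqOp_eq_zero (h : seqOp μ v = 0) (h0 : v 0 = 0) : v = 0 :=
  eq_zero_of_jacobi_eq_zero (fun n => (coeffC_pos n).ne') ((seqOp_eq_jacobi μ v).symm.trans h) h0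

end Coefficients

section Nonpositive

variable {μ : ℝ} {u v : ℕ → ℝ}

theorem normFactor_mul_seqOp (μ : ℝ) (u : ℕ → ℝ) (n : ℕ) :
    normFactor n * seqOp μ (fun n => normFactor n * u n) n =
      μ * (normFactor n ^ 2 * diagWeight n) * u n +
        jacobi (fun n => normFactor n ^ 2 * coeffA 0 (n + 1)) bond u n := by
  rw [seqOp_eq_add, mul_add, seqOp_eq_jacobi, mul_jacobi_mul]
  simp only [normFactor_mul_coeffC]
  ring

theorem normFactor_mul_seqOp_zero (μ : ℝ) (u : ℕ → ℝ) :
    normFactor 0 * seqOp μ (fun n => normFactor n * u n) 0 =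
      μ * (normFactor 0 ^ 2 * diagWeight 0) * u 0 + 2 / 3 * u 0 + bond 0 * (u 1 - u 0) := by
  rw [normFactor_mul_seqOp, jacobi_zero, zero_add, normFactor_sq_mul_coeffA_zero_one]
  ring

theorem normFactor_mul_seqOp_succ (μ : ℝ) (u : ℕ → ℝ) (n : ℕ) :
    normFactor (n + 1) * seqOp μ (fun n => normFactor n * u n) (n + 1) =
      μ * (normFactor (n + 1) ^ 2 * diagWeight (n + 1)) * u (n + 1) +
        bond (n + 1) * (u (n + 2) - u (n + 1)) - bond n * (u (n + 1) - u n) := by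
  rw [normFactor_mul_seqOp, jacobi_succ, normFactor_sq_mul_coeffA_zero_add_two]
  ring

theorem third_le_of_seqOp_eq_zero (hμ : μ ≤ 0) (hu0 : 0 ≤ u 0)
    (h : seqOp μ (fun n => normFactor n * u n) = 0) (n : ℕ) : u 0 / 3 ≤ u n := by
  have hterm {n : ℕ} (hn : 0 ≤ u n) : μ * (normFactor n ^ 2 * diagWeight n) * u n ≤ 0 :=
    mul_nonpos_of_nonpos_of_nonneg
      (mul_nonpos_of_nonpos_of_nonneg hμ (mul_nonneg (sq_nonneg _) (diagWeight_pos n).le)) hn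
  have hflux0 : -(2 / 3 * u 0) ≤ bond 0 * (u 1 - u 0) := by
    have h0 := normFactor_mul_seqOp_zero μ u
    rw [h, Pi.zero_apply, mul_zero] at h0
    linarith [hterm hu0]
  have hflux (n : ℕ) (hn : 0 ≤ u (n + 1)) :
      bond n * (u (n + 1) - u n) ≤ bond (n + 1) * (u (n + 2) - u (n + 1)) := by
    have hn' := normFactor_mul_seqOp_succ μ u n
    rw [h, Pi.zero_apply, mul_zero] at hn'
    linarith [hterm hn]
  have hle := le_of_flux_monotone (q := 2 / 3) (θ := 2 / 3) bond_pos (by norm_num)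
    (fun n => by linarith [sum_range_inv_bond_le_one n]) hu0 hflux0 hflux n
  linarith

theorem apply_zero_nonpos_of_seqOp_eq_zero (hμ : μ ≤ 0) (h : seqOp μ v = 0)
    (hv : Tendsto v atTop (𝓝 0)) : v 0 ≤ 0 := by
  by_contra! hpos
  have hv0 : 0 < v 0 / normFactor 0 := div_pos hpos (normFactor_pos 0)
  have hscale : (fun n => normFactor n * (v n / normFactor n)) = v :=
    funext fun n => mul_div_cancel₀ _ (normFactor_pos n).ne'
  have hle (n : ℕ) : v 0 / normFactor 0 / 3 ≤ v n / normFactor n :=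
    third_le_of_seqOp_eq_zero (u := fun n => v n / normFactor n) hμ hv0.le
      ((congrArg _ hscale).trans h) n
  have hlim : v 0 / normFactor 0 / 3 ≤ 0 := ge_of_tendsto' hv fun n => by
    have hvn : 0 < v n := (div_pos_iff_of_pos_right (normFactor_pos n)).1
      ((by positivity : (0 : ℝ) < v 0 / normFactor 0 / 3).trans_le (hle n))
    exact (hle n).trans (div_le_self hvn.le (one_le_normFactor n))
  linarith

theorem eq_zero_of_seqOp_eq_zero_of_nonpos (hμ : μ ≤ 0) (h : seqOp μ v = 0)
    (hv : Tendsto v atTop (𝓝 0)) : v = 0 := by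
  refine eq_zero_of_seqOp_eq_zero h
    (le_antisymm (apply_zero_nonpos_of_seqOp_eq_zero hμ h hv) ?_)
  have hneg := apply_zero_nonpos_of_seqOp_eq_zero (v := (-1 : ℝ) • v) hμ
    (by rw [seqOp_smul, h, smul_zero]) (by simpa using! hv.const_smul (-1 : ℝ))
  simpa using hneg

end Nonpositive

section Kernel

variable {α μ s t : ℝ} {v w : ℕ → ℝ}

theorem hasGrowth_coeffA (μ : ℝ) : HasGrowth 2 fun n => coeffA μ (n + 1) := by
  rw [funext (coeffA_eq μ)]
  exact (hasGrowth_diagWeight.const_mul μ).add (hasGrowth_coeffA_zero.mono one_le_two)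

theorem summable_mul_seqOp (h : 2 ≤ s + t) (hv : v ∈ hSubmodule s) (hw : w ∈ hSubmodule t) :
    Summable fun n => v n * seqOp μ w n := by
  rw [seqOp_eq_jacobi]
  exact summable_mul_jacobi (hasGrowth_coeffA μ) (hasGrowth_coeffC.mono one_le_two) h hv hw

theorem tsum_mul_seqOp (h : 2 ≤ s + t) (hv : v ∈ hSubmodule s) (hw : w ∈ hSubmodule t) :
    ∑' n, v n * seqOp μ w n = ∑' n, w n * seqOp μ v n := by
  rw [seqOp_eq_jacobi, seqOp_eq_jacobi]
  exact tsum_mul_jacobi (hasGrowth_coeffA μ) (hasGrowth_coeffC.mono one_le_two) h hv hw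

theorem isEllTwoSymmetric_opA (hα : -1 ≤ α) (μ : ℝ) : IsEllTwoSymmetric (opA α μ) := by
  intro v w
  have h : 2 ≤ (α + 2) + (α + 2) := by linarith
  simp only [opA_apply, mul_comm (seqOp μ _ _)]
  exact ⟨summable_mul_seqOp h v.mem w.mem, summable_mul_seqOp h w.mem v.mem,
    tsum_mul_seqOp h v.mem w.mem⟩

theorem mem_hSubmodule_add_one_of_seqOp_eq_zero (hμ : μ ≠ 0) (h : seqOp μ v = 0)
    (hv : v ∈ hSubmodule s) : v ∈ hSubmodule (s + 1) := by
  have h0 : seqOp 0 v ∈ hSubmodule (s - 1) := by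
    rw [seqOp_eq_jacobi]
    exact jacobi_mem hasGrowth_coeffA_zero hasGrowth_coeffC (sub_add_cancel s 1).le hv
  have hsolve : v = (-μ⁻¹) • fun n => (diagWeight n)⁻¹ * seqOp 0 v n := by
    funext n
    have hn := congrFun h n
    have hd := (diagWeight_pos n).ne'
    rw [seqOp_eq_add, Pi.zero_apply, add_eq_zero_iff_neg_eq] at hn
    rw [Pi.smul_apply, smul_eq_mul, ← hn]
    field_simp
  rw [hsolve]
  exact Submodule.smul_mem _ _ (hasGrowth_inv_diagWeight.mul_mem (by linarith) h0)

theorem mem_hSubmodule_of_seqOp_eq_zero (hμ : μ ≠ 0) (h : seqOp μ v = 0)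
    (hv : v ∈ hSubmodule s) (β : ℝ) : v ∈ hSubmodule β := by
  have key (k : ℕ) : v ∈ hSubmodule (s + k) := by
    induction k with
    | zero => simpa using hv
    | succ k ih =>
      rw [Nat.cast_succ, ← add_assoc]
      exact mem_hSubmodule_add_one_of_seqOp_eq_zero hμ h ih
  obtain ⟨k, hk⟩ := exists_nat_ge (β - s)
  exact hSubmodule_antitone (by linarith) (key k)

end Kernel

section Operator

variable {α μ : ℝ} {v : WeightedSeq (α + 2)} {f : WeightedSeq α}

theorem mem_ker_opA : v ∈ (opA α μ).ker ↔ seqOp μ v = 0 :=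
  ⟨fun h => congrArg (WeightedSeq.toSeq α) h, fun h => WeightedSeq.ext fun n => congrFun h n⟩

theorem ker_opA_eq_bot_of_nonpos (hα : -2 ≤ α) (hμ : μ ≤ 0) : (opA α μ).ker = ⊥ :=
  (Submodule.eq_bot_iff _).2 fun v hv => WeightedSeq.ext fun n =>
    congrFun (eq_zero_of_seqOp_eq_zero_of_nonpos hμ (mem_ker_opA.1 hv)
      (tendsto_zero_of_mem (by linarith) v.mem)) n

theorem eq_zero_of_mem_ker_opA (hv : v ∈ (opA α μ).ker) (h0 : v 0 = 0) : v = 0 :=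
  WeightedSeq.ext fun n => congrFun (eq_zero_of_seqOp_eq_zero (mem_ker_opA.1 hv) h0) n

theorem rank_ker_opA_le_one (α μ : ℝ) : Module.rank ℝ (opA α μ).ker ≤ 1 := by
  let φ : (opA α μ).ker →ₗ[ℝ] ℝ :=
    (WeightedSeq.evalCLM (α + 2) 0 : WeightedSeq (α + 2) →ₗ[ℝ] ℝ) ∘ₗ (opA α μ).ker.subtype
  have hφ : Function.Injective φ := (injective_iff_map_eq_zero φ).2 fun v hv =>
    Subtype.ext (eq_zero_of_mem_ker_opA v.2 hv)
  exact (LinearMap.rank_le_of_injective φ hφ).trans_eq (Module.rank_self ℝ)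

/-- The diagonal part of `𝒜(μ)` divided by `μ`, as an operator `h^{α+2} → h^α`. -/
noncomputable def diagCLM (α : ℝ) : WeightedSeq (α + 2) →L[ℝ] WeightedSeq α :=
  WeightedSeq.mulCLM hasGrowth_diagWeight le_rfl

theorem isInvertible_smul_diagCLM (hμ : μ ≠ 0) : (μ • diagCLM α).IsInvertible := by
  obtain ⟨D, hD⟩ : (diagCLM α).IsInvertible := WeightedSeq.isInvertible_mulCLM hasGrowth_diagWeight
    hasGrowth_inv_diagWeight (fun n => (diagWeight_pos n).ne') rfl
  exact ⟨D.trans (ContinuousLinearEquiv.smulLeft (Units.mk0 μ hμ)), by rw [← hD]; rfl⟩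

theorem opA_eq_smul_add (α μ : ℝ) : opA α μ = μ • diagCLM α + opA α 0 :=
  ContinuousLinearMap.ext fun v => WeightedSeq.ext fun n =>
    (seqOp_eq_add μ v n).trans (by simp [diagCLM, mul_assoc])

theorem hasDerivAt_opA (α μ : ℝ) : HasDerivAt (opA α) (diagCLM α) μ := by
  rw [funext (opA_eq_smul_add α)]
  simpa using ((hasDerivAt_id μ).smul_const (diagCLM α)).add_const (opA α 0)

theorem isCompactOperator_opA_zero (α : ℝ) : IsCompactOperator (opA α 0) := by
  have h : opA α 0 = WeightedSeq.jacobiCLM hasGrowth_coeffA_zero hasGrowth_coeffC (by linarith) :=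
    ContinuousLinearMap.ext fun v => WeightedSeq.ext fun n => by simp [seqOp_eq_jacobi]
  exact h ▸ WeightedSeq.isCompactOperator_jacobiCLM _ _ (by linarith)

theorem isInvertible_opA_add {G : WeightedSeq (α + 2) →L[ℝ] WeightedSeq α} (hμ : μ ≠ 0)
    (hG : IsCompactOperator G) (hker : ∀ v, opA α μ v + G v = 0 → v = 0) :
    (opA α μ + G).IsInvertible := by
  rw [opA_eq_smul_add, add_assoc]
  refine isInvertible_add_of_isCompactOperator (isInvertible_smul_diagCLM hμ)
    ((isCompactOperator_opA_zero α).add hG) fun v hv => hker v ?_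
  rw [← hv, opA_eq_smul_add]
  exact add_assoc _ _ _

theorem isInvertible_opA (hμ : μ ≠ 0) (hker : (opA α μ).ker = ⊥) : (opA α μ).IsInvertible := by
  have h := isInvertible_opA_add (α := α) (G := 0) hμ isCompactOperator_zero fun v hv =>
    (Submodule.eq_bot_iff _).1 hker v (by simpa using hv)
  rwa [add_zero] at h

theorem tsum_mul_eq_zero_of_mem_ker (hμ : μ ≠ 0) (hv : v ∈ (opA α μ).ker)
    (hf : f ∈ (opA α μ).range) : ∑' n, v n * f n = 0 := by
  obtain ⟨w, rfl⟩ := hf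
  have hseq := mem_ker_opA.1 hv
  refine (tsum_mul_seqOp (s := -α) (by linarith)
    (mem_hSubmodule_of_seqOp_eq_zero hμ hseq v.mem _) w.mem).trans ?_
  simp only [hseq, Pi.zero_apply, mul_zero, tsum_zero]

theorem unitSeq_zero_notMem_range (hμ : μ ≠ 0) (h : (opA α μ).ker ≠ ⊥) :
    WeightedSeq.unitSeq α 0 ∉ (opA α μ).range := by
  obtain ⟨v, hv, hv0⟩ := Submodule.exists_mem_ne_zero_of_ne_bot h
  intro he
  refine hv0 (eq_zero_of_mem_ker_opA hv ?_)
  simpa [WeightedSeq.unitSeq_apply] using tsum_mul_eq_zero_of_mem_ker hμ hv he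

theorem isInvertible_opA_add_smulRight (hμ : μ ≠ 0) (h : (opA α μ).ker ≠ ⊥) :
    (opA α μ + (WeightedSeq.evalCLM (α + 2) 0).smulRight
      (WeightedSeq.unitSeq α 0)).IsInvertible := by
  refine isInvertible_opA_add hμ ((isCompactOperator_of_locallyCompactSpace_dom
    (WeightedSeq.evalCLM (α + 2) 0)).clm_comp (ContinuousLinearMap.toSpanSingleton ℝ _))
    fun v hv => ?_
  have hv' : opA α μ v + v 0 • WeightedSeq.unitSeq α 0 = 0 := hv
  have h0 : v 0 = 0 := by
    by_contra hne
    refine unitSeq_zero_notMem_range hμ h (((opA α μ).range.smul_mem_iff hne).1 ?_)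
    exact ⟨-v, (map_neg _ _).trans (neg_eq_of_add_eq_zero_right hv')⟩
  rw [h0, zero_smul, add_zero] at hv'
  exact eq_zero_of_mem_ker_opA hv' h0

theorem finrank_ker_opA (hμ : μ ≠ 0) (h : (opA α μ).ker ≠ ⊥) :
    Module.finrank ℝ (opA α μ).ker = 1 :=
  finrank_ker_of_isInvertible_add_smulRight (isInvertible_opA_add_smulRight hμ h)
    (unitSeq_zero_notMem_range hμ h)

theorem isFredholmOfIndexZero_opA (hμ : μ ≠ 0) : IsFredholmOfIndexZero (opA α μ) := by
  by_cases h : (opA α μ).ker = ⊥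
  · exact isFredholmOfIndexZero_of_isInvertible (isInvertible_opA hμ h)
  · exact isFredholmOfIndexZero_of_isInvertible_add_smulRight
      (isInvertible_opA_add_smulRight hμ h) (unitSeq_zero_notMem_range hμ h)

theorem diagCLM_apply_notMem_range (hμ : μ ≠ 0) (hv : v ∈ (opA α μ).ker) (hv0 : v ≠ 0) :
    diagCLM α v ∉ (opA α μ).range := by
  intro hD
  have hsmooth := mem_hSubmodule_of_seqOp_eq_zero hμ (mem_ker_opA.1 hv) v.mem (-α)
  have hsum := summable_mul_of_mem (neg_add_cancel α).ge hsmooth (diagCLM α v).mem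
  have heq (n : ℕ) : v n * diagCLM α v n = diagWeight n * v n ^ 2 := by
    simp only [diagCLM, WeightedSeq.mulCLM_apply]
    ring
  have hzero := (hasSum_zero_iff_of_nonneg fun n => by
    simpa only [heq] using! mul_nonneg (diagWeight_pos n).le (sq_nonneg (v n))).1
    (tsum_mul_eq_zero_of_mem_ker hμ hv hD ▸ hsum.hasSum)
  have h0 := (heq 0).symm.trans (congrFun hzero 0)
  exact hv0 (eq_zero_of_mem_ker_opA hv
    (pow_eq_zero_iff two_ne_zero |>.1 ((mul_eq_zero.1 h0).resolve_left (diagWeight_pos 0).ne')))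

end Operator

/-- The square roots of the diagonal weights. -/
noncomputable def rootWeight (n : ℕ) : ℝ := √(diagWeight n)

/-- The diagonal entries of `-D^{-1/2} 𝒜(0) D^{-1/2}`, where `D` is the diagonal operator with the
entries `diagWeight`, so that `𝒜(μ) = μ D + 𝒜(0)`. -/
noncomputable def symDiag (n : ℕ) : ℝ := -(diagWeight n)⁻¹ * coeffA 0 (n + 1)

/-- The off-diagonal entries of `-D^{-1/2} 𝒜(0) D^{-1/2}`, see `symDiag`. -/
noncomputable def symOff (n : ℕ) : ℝ :=
  -((rootWeight n)⁻¹ * (rootWeight (n + 1))⁻¹) * coeffC (n + 1)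

section Symmetrization

variable {α μ : ℝ} {v w : ℕ → ℝ}

theorem rootWeight_pos (n : ℕ) : 0 < rootWeight n := Real.sqrt_pos.2 (diagWeight_pos n)

theorem rootWeight_sq (n : ℕ) : rootWeight n ^ 2 = diagWeight n :=
  Real.sq_sqrt (diagWeight_pos n).le

theorem hasGrowth_rootWeight : HasGrowth 1 rootWeight :=
  hasGrowth_diagWeight.sqrt.mono (by norm_num)

theorem hasGrowth_inv_rootWeight : HasGrowth (-1) fun n => (rootWeight n)⁻¹ := by
  simp only [rootWeight, ← Real.sqrt_inv]
  exact hasGrowth_inv_diagWeight.sqrt.mono (by norm_num)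

theorem hasGrowth_symDiag : HasGrowth (-1) symDiag :=
  (hasGrowth_inv_diagWeight.neg.mul hasGrowth_coeffA_zero).mono (by norm_num)

theorem hasGrowth_symOff : HasGrowth (-1) symOff :=
  ((hasGrowth_inv_rootWeight.mul hasGrowth_inv_rootWeight.comp_succ).neg.mul
    hasGrowth_coeffC).mono (by norm_num)

theorem rootWeight_mul_jacobi_symDiag_symOff (v : ℕ → ℝ) (n : ℕ) :
    rootWeight n * jacobi symDiag symOff (fun n => rootWeight n * v n) n = -seqOp 0 v n := by
  have hdiag (n : ℕ) : rootWeight n ^ 2 * symDiag n = -coeffA 0 (n + 1) := by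
    rw [rootWeight_sq, symDiag, neg_mul, mul_neg, mul_inv_cancel_left₀ (diagWeight_pos n).ne']
  have hoff (n : ℕ) : rootWeight n * rootWeight (n + 1) * symOff n = -coeffC (n + 1) := by
    rw [symOff, ← mul_inv, neg_mul, mul_neg,
      mul_inv_cancel_left₀ (mul_pos (rootWeight_pos n) (rootWeight_pos _)).ne']
  rw [mul_jacobi_mul, funext hdiag, funext hoff, jacobi_neg_apply, seqOp_eq_jacobi]

theorem jacobi_symDiag_symOff_eq_smul_iff :
    (jacobi symDiag symOff fun n => rootWeight n * v n) = (μ • fun n => rootWeight n * v n) ↔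
      seqOp μ v = 0 := by
  have key (n : ℕ) : seqOp μ v n = rootWeight n *
      (μ * (rootWeight n * v n) - jacobi symDiag symOff (fun n => rootWeight n * v n) n) := by
    rw [mul_sub, rootWeight_mul_jacobi_symDiag_symOff, seqOp_eq_add, ← rootWeight_sq]
    ring
  rw [eq_comm]
  simp only [funext_iff, key, Pi.smul_apply, smul_eq_mul, Pi.zero_apply, mul_eq_zero,
    (rootWeight_pos _).ne', false_or, sub_eq_zero]

theorem ker_opA_ne_bot_iff (hα : -2 ≤ α) :
    (opA α μ).ker ≠ ⊥ ↔ μ ∈ jacobiEigenvalues symDiag symOff := by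
  constructor
  · intro h
    have hμ : μ ≠ 0 := fun hμ => h (ker_opA_eq_bot_of_nonpos hα hμ.le)
    obtain ⟨v, hv, hv0⟩ := Submodule.exists_mem_ne_zero_of_ne_bot h
    have hseq := mem_ker_opA.1 hv
    have hsmooth := mem_hSubmodule_of_seqOp_eq_zero hμ hseq v.mem 1
    refine ⟨fun n => rootWeight n * v n, hasGrowth_rootWeight.mul_mem (by norm_num) hsmooth,
      fun hw => hv0 (WeightedSeq.ext fun n => ?_), jacobi_symDiag_symOff_eq_smul_iff.2 hseq⟩
    simpa [(rootWeight_pos n).ne'] using congrFun hw n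
  · rintro ⟨w, hw, hw0, h⟩
    obtain ⟨v, rfl⟩ : ∃ v : ℕ → ℝ, w = fun n => rootWeight n * v n :=
      ⟨fun n => (rootWeight n)⁻¹ * w n, funext fun n => by
        rw [mul_inv_cancel_left₀ (rootWeight_pos n).ne']⟩
    have hv0 : v ≠ 0 := by
      rintro rfl
      simp [← Pi.zero_def] at hw0
    have hseq := jacobi_symDiag_symOff_eq_smul_iff.1 h
    have hv : v ∈ hSubmodule 1 := by
      simpa [(rootWeight_pos _).ne'] using
        hasGrowth_inv_rootWeight.mul_mem (α := 1) (by norm_num) hw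
    have hμ : μ ≠ 0 := fun hμ => hv0 <|
      eq_zero_of_seqOp_eq_zero_of_nonpos hμ.le hseq (tendsto_zero_of_mem zero_le_one hv)
    have hsmooth := mem_hSubmodule_of_seqOp_eq_zero hμ hseq hv (α + 2)
    refine (Submodule.ne_bot_iff _).2 ⟨.mk v hsmooth, mem_ker_opA.2 hseq, fun hz => hv0 ?_⟩
    exact congrArg (WeightedSeq.toSeq _) hz

theorem pos_of_mem_jacobiEigenvalues (h : μ ∈ jacobiEigenvalues symDiag symOff) : 0 < μ := by
  by_contra! hμ
  exact (ker_opA_ne_bot_iff (α := 0) (by norm_num)).2 h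
    (ker_opA_eq_bot_of_nonpos (by norm_num) hμ)

theorem exists_strictAnti_ker_opA_ne_bot_iff (hα : -2 ≤ α) :
    ∃ m : ℕ → ℝ, StrictAnti m ∧ (∀ k, 0 < m k) ∧ Tendsto m atTop (𝓝 0) ∧
      ∀ μ, (opA α μ).ker ≠ ⊥ ↔ μ ∈ Set.range m := by
  obtain ⟨m, hanti, hrange, hlim⟩ := exists_strictAnti_range_eq_jacobiEigenvalues
    hasGrowth_symDiag hasGrowth_symOff (by norm_num) fun μ => pos_of_mem_jacobiEigenvalues
  refine ⟨m, hanti, fun k => pos_of_mem_jacobiEigenvalues (hrange ▸ Set.mem_range_self k), hlim,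
    fun μ => ?_⟩
  rw [hrange, ker_opA_ne_bot_iff hα]

end Symmetrization

section Gershgorin

theorem symOff_sq (n : ℕ) : symOff n ^ 2 = (2 * n + 4) * (2 * n + 1) * (2 * n + 3) /
    ((4 * n + 5) * (4 * n + 9) * (2 * n + 6) * (4 * n + 7) ^ 2) := by
  have hC : coeffC (n + 1) = bond n / (normFactor n * normFactor (n + 1)) :=
    eq_div_of_mul_eq (mul_pos (normFactor_pos n) (normFactor_pos _)).ne'
      ((mul_comm _ _).trans (normFactor_mul_coeffC n))
  rw [symOff, hC, mul_pow, neg_sq, mul_pow, inv_pow, inv_pow, div_pow, mul_pow, rootWeight_sq,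
    rootWeight_sq, normFactor_sq, normFactor_sq]
  unfold bond diagWeight
  push_cast
  field_simp
  ring

theorem abs_symOff_zero : |symOff 0| = √2 / (21 * √5) := by
  rw [← sq_eq_sq₀ (abs_nonneg _) (by positivity), sq_abs, symOff_sq, div_pow, mul_pow,
    Real.sq_sqrt (by norm_num), Real.sq_sqrt (by norm_num)]
  norm_num

theorem abs_symOff_one : |symOff 1| = √5 / (22 * √13) := by
  rw [← sq_eq_sq₀ (abs_nonneg _) (by positivity), sq_abs, symOff_sq, div_pow, mul_pow,
    Real.sq_sqrt (by norm_num), Real.sq_sqrt (by norm_num)]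
  norm_num

theorem abs_symOff_succ_le (n : ℕ) : |symOff (n + 1)| ≤ 3 / 100 := by
  have hn : (0 : ℝ) ≤ n := n.cast_nonneg
  refine le_of_sq_le_sq ?_ (by norm_num)
  rw [sq_abs, symOff_sq, div_le_iff₀ (by positivity)]
  push_cast
  ring_nf
  nlinarith [pow_nonneg hn 2, pow_nonneg hn 3, pow_nonneg hn 4, pow_nonneg hn 5]

theorem symDiag_zero : symDiag 0 = 11 / 210 := by
  norm_num [symDiag, coeffA, diagWeight]

theorem symDiag_one : symDiag 1 = 127 / 2079 := by
  norm_num [symDiag, coeffA, diagWeight]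

theorem symDiag_add_two (n : ℕ) : symDiag (n + 2) =
    (bond (n + 1) + bond (n + 2)) / ((4 * n + 13) * diagWeight (n + 2)) := by
  have hA := normFactor_sq_mul_coeffA_zero_add_two (n + 1)
  have hD := diagWeight_pos (n + 2)
  rw [normFactor_sq] at hA
  push_cast at hA
  rw [symDiag, eq_div_iff (by positivity)]
  field_simp
  linarith

theorem abs_symDiag_add_two_le (n : ℕ) : |symDiag (n + 2)| ≤ 55 / 1000 := by
  have hn : (0 : ℝ) ≤ n := n.cast_nonneg
  have hD := diagWeight_pos (n + 2)
  have hB := add_pos (bond_pos (n + 1)) (bond_pos (n + 2))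
  rw [symDiag_add_two, abs_of_pos (by positivity), div_le_iff₀ (by positivity)]
  unfold bond diagWeight
  push_cast
  rw [div_add_div _ _ (by positivity) (by positivity), div_le_iff₀ (by positivity)]
  ring_nf
  nlinarith [pow_nonneg hn 2, pow_nonneg hn 3, pow_nonneg hn 4, pow_nonneg hn 5]

theorem abs_gershgorin_sub_lt :
    |√2 / (21 * √5) + √5 / (22 * √13) + 127 / 2079 - 0.119394| < 5e-7 := by
  have h10 : √2 / (21 * √5) = √10 / 105 := by
    rw [← sq_eq_sq₀ (by positivity) (by positivity), div_pow, div_pow, mul_pow,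
      Real.sq_sqrt (by norm_num), Real.sq_sqrt (by norm_num), Real.sq_sqrt (by norm_num)]
    norm_num
  have h65 : √5 / (22 * √13) = √65 / 286 := by
    rw [← sq_eq_sq₀ (by positivity) (by positivity), div_pow, div_pow, mul_pow,
      Real.sq_sqrt (by norm_num), Real.sq_sqrt (by norm_num), Real.sq_sqrt (by norm_num)]
    norm_num
  have h10_lower : 3.162277 < √10 := Real.lt_sqrt_of_sq_lt (by norm_num)
  have h10_upper : √10 < 3.162278 := (Real.sqrt_lt' (by norm_num)).2 (by norm_num)
  have h65_lower : 8.062257 < √65 := Real.lt_sqrt_of_sq_lt (by norm_num)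
  have h65_upper : √65 < 8.062258 := (Real.sqrt_lt' (by norm_num)).2 (by norm_num)
  rw [h10, h65, abs_lt]
  norm_num only at h10_lower h10_upper h65_lower h65_upper ⊢
  constructor <;> linarith

theorem le_of_mem_jacobiEigenvalues {μ : ℝ} (h : μ ∈ jacobiEigenvalues symDiag symOff) :
    μ ≤ √2 / (21 * √5) + √5 / (22 * √13) + 127 / 2079 := by
  obtain ⟨w, hw, hw0, heq⟩ := h
  have hvalue := (abs_lt.1 abs_gershgorin_sub_lt).1
  norm_num only at hvalue
  refine (le_abs_self μ).trans
    (abs_le_of_jacobi_eq_smul ?_ (fun n => ?_) (tendsto_zero_of_mem le_rfl hw) hw0 heq)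
  · have hoff : 0 ≤ √5 / (22 * √13) := by positivity
    rw [abs_symOff_zero, symDiag_zero, abs_of_pos (by norm_num)]
    linarith
  · cases n with
    | zero =>
      rw [zero_add, abs_symOff_zero, abs_symOff_one, symDiag_one, abs_of_pos (by norm_num)]
      linarith
    | succ n =>
      linarith [abs_symDiag_add_two_le n, abs_symOff_succ_le n, abs_symOff_succ_le (n + 1)]

end Gershgorin

theorem mainTheorem4_general (α : ℝ) (hα : -1 ≤ α) :
    (∀ μ : ℝ, μ ≠ 0 → IsEllTwoSymmetric (opA α μ) ∧ IsFredholmOfIndexZero (opA α μ)) ∧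
    (∀ μ : ℝ, 0 < μ →
      Module.rank ℝ (opA α μ).ker ≤ 1 ∧
      ∀ v ∈ (opA α μ).ker, ∀ β : ℝ, 0 ≤ β → WeightedSeq.toSeq (α + 2) v ∈ hSubmodule β) ∧
    (∀ μ : ℝ, μ ≤ 0 → (opA α μ).ker = ⊥) ∧
    ∃ m : ℕ → ℝ,
      StrictAnti m ∧ (∀ k, 0 < m k) ∧ Tendsto m atTop (𝓝 0) ∧
      (∀ k, Module.finrank ℝ (opA α (m k)).ker = 1) ∧
      (∀ μ : ℝ, μ ≠ 0 → (∀ k, μ ≠ m k) → (opA α μ).IsInvertible) ∧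
      (m 0 ≤ √2 / (21 * √5) + √5 / (22 * √13) + 127 / 2079 ∧
        |√2 / (21 * √5) + √5 / (22 * √13) + 127 / 2079 - 0.119394| < 5e-7) ∧
      (∀ k, ∃ A' : WeightedSeq (α + 2) →L[ℝ] WeightedSeq α,
        HasDerivAt (fun μ : ℝ => opA α μ) A' (m k) ∧
        ∀ v ∈ (opA α (m k)).ker, v ≠ 0 → A' v ∉ (opA α (m k)).range) := by
  obtain ⟨m, hanti, hpos, hlim, hker⟩ := exists_strictAnti_ker_opA_ne_bot_iff (α := α) (by linarith)
  have hker_m (k : ℕ) : (opA α (m k)).ker ≠ ⊥ := (hker _).2 ⟨k, rfl⟩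
  refine ⟨fun μ hμ => ⟨isEllTwoSymmetric_opA hα μ, isFredholmOfIndexZero_opA hμ⟩,
    fun μ hμ => ⟨rank_ker_opA_le_one α μ, fun v hv β _ =>
      mem_hSubmodule_of_seqOp_eq_zero hμ.ne' (mem_ker_opA.1 hv) v.mem β⟩,
    fun μ hμ => ker_opA_eq_bot_of_nonpos (by linarith) hμ, m, hanti, hpos, hlim,
    fun k => finrank_ker_opA (hpos k).ne' (hker_m k), fun μ hμ hne => isInvertible_opA hμ ?_,
    ⟨le_of_mem_jacobiEigenvalues ((ker_opA_ne_bot_iff (by linarith)).1 (hker_m 0)),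
      abs_gershgorin_sub_lt⟩,
    fun k => ⟨diagCLM α, hasDerivAt_opA α (m k),
      fun v hv hv0 => diagCLM_apply_notMem_range (hpos k).ne' hv hv0⟩⟩
  by_contra h
  obtain ⟨k, hk⟩ := (hker μ).1 h
  exact hne k hk.symm

theorem mainTheorem4 (α : ℝ) (hα : 0 ≤ α) :
    (∀ μ : ℝ, μ ≠ 0 → IsEllTwoSymmetric (opA α μ) ∧ IsFredholmOfIndexZero (opA α μ)) ∧
    (∀ μ : ℝ, 0 < μ →
      Module.rank ℝ (opA α μ).ker ≤ 1 ∧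
      ∀ v ∈ (opA α μ).ker, ∀ β : ℝ, 0 ≤ β → WeightedSeq.toSeq (α + 2) v ∈ hSubmodule β) ∧
    (∀ μ : ℝ, μ ≤ 0 → (opA α μ).ker = ⊥) ∧
    ∃ m : ℕ → ℝ,
      StrictAnti m ∧ (∀ k, 0 < m k) ∧ Tendsto m atTop (𝓝 0) ∧
      (∀ k, Module.finrank ℝ (opA α (m k)).ker = 1) ∧
      (∀ μ : ℝ, μ ≠ 0 → (∀ k, μ ≠ m k) → (opA α μ).IsInvertible) ∧
      (m 0 ≤ √2 / (21 * √5) + √5 / (22 * √13) + 127 / 2079 ∧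
        |√2 / (21 * √5) + √5 / (22 * √13) + 127 / 2079 - 0.119394| < 5e-7) ∧
      (∀ k, ∃ A' : WeightedSeq (α + 2) →L[ℝ] WeightedSeq α,
        HasDerivAt (fun μ : ℝ => opA α μ) A' (m k) ∧
        ∀ v ∈ (opA α (m k)).ker, v ≠ 0 → A' v ∉ (opA α (m k)).range) :=
  mainTheorem4_general α (by linarith)
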